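/- Call a metric on a topological space $X$ \emph{compatible} if it induces the topology of $X$, and \emph{proper} if all its closed balls are compact. For a metric $d$ on $X$ let $\operatorname{Iso}(X,d)$ be the group of all bijective isometries of $(X,d)$. A family $\mathcal F$ of functions $X\to X$ is \emph{evenly continuous} if for all $x,y\in X$ and every neighbourhood $W$ of $y$ there are neighbourhoods $U$ of $x$ and $V$ of $y$ such that $f\in\mathcal F$ and $f(x)\in V$ imply $f(U)\subset W$; it is \emph{pointwise precompact} if for each $x\in X$ the closure of $\{f(x): f\in\mathcal F\}$ is compact. The \emph{symmetrized 2-hull} of $\mathcal F$ is the family of all functions $g\colon X\to X$ such that for all $x,y\in X$ (not necessarily distinct) there is $f\in\mathcal F$ with $\{g(x),g(y)\}=\{f(x),f(y)\}$. **Theorem.** Let $X$ be a locally compact Polish space and let $G$ be a group (under composition) of homeomorphisms of $X$ onto itself such that $(\operatorname{card} G,\operatorname{card} X)\neq(1,2)$. The following conditions are equivalent: (i) there exists a proper compatible metric $d$ on $X$ such that $\operatorname{Iso}(X,d)=G$; (ii) there exists a $G$-invariant proper compatible metric on $X$ (that is, one with $d(g(x),g(y))=d(x,y)$ for all $g\in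 G$ and $x,y\in X$), and for every $G$-invariant proper compatible metric $d$ on $X$ and every $\varepsilon>0$ there is a proper compatible metric $\varrho$ on $X$ such that $d\le\varrho\le(1+\varepsilon)d$ on $X\times X$ and $\operatorname{Iso}(X,\varrho)=G$; (iii) each of the following three conditions is fulfilled: * $G$ is closed in the space $C(X,X)$ of all continuous functions $X\to X$ equipped with the compact-open topology; * for every compact set $K\subset X$ the family $D_K=\{h\in G: h(K)\cap K\neq\varnothing\}$ is evenly continuous and pointwise precompact; * $G$ equals its symmetrized 2-hull. -/

import Mathlib

open Set Topology

/-- The set of all metrics on the topological space `X` which induce the given topology of `X`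
and are proper, i.e. all of whose closed balls are compact. -/
def properMetrics (X : Type*) [t : TopologicalSpace X] : Set (MetricSpace X) :=
  {d | d.toUniformSpace.toTopologicalSpace = t ∧ @ProperSpace X d.toPseudoMetricSpace}

/-- `Iso(X, d)`: all bijective isometries of `(X, d)`, as maps of `X` into itself. -/
def isometryMaps {X : Type*} (d : MetricSpace X) : Set (X → X) :=
  {f | Function.Bijective f ∧ ∀ x y : X, d.dist (f x) (f y) = d.dist x y}

/-- The members of a set of homeomorphisms, as maps of `X` into itself. -/
def underlyingMaps {X : Type*} [TopologicalSpace X] (G : Set (X ≃ₜ X)) : Set (X → X) :=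
  {f | ∃ g ∈ G, (g : X → X) = f}

/-- The members of a set of homeomorphisms, as points of the space `C(X, X)`, which carries the
compact-open topology. -/
def underlyingContinuousMaps {X : Type*} [TopologicalSpace X] (G : Set (X ≃ₜ X)) : Set C(X, X) :=
  {f | ∃ g ∈ G, (⟨g, g.continuous⟩ : C(X, X)) = f}

/-- The metric `d` is invariant under all members of `G`. -/
def IsInvariantMetric {X : Type*} [TopologicalSpace X] (G : Subgroup (X ≃ₜ X))
    (d : MetricSpace X) : Prop :=
  ∀ g ∈ G, ∀ x y : X, d.dist (g x) (g y) = d.dist x y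

/-- Evenly continuous families of functions. -/
def IsEvenlyContinuous {X Y : Type*} [TopologicalSpace X] [TopologicalSpace Y]
    (F : Set (X → Y)) : Prop :=
  ∀ (x : X) (y : Y), ∀ W ∈ 𝓝 y, ∃ U ∈ 𝓝 x, ∃ V ∈ 𝓝 y, ∀ f ∈ F, f x ∈ V → f '' U ⊆ W

/-- Pointwise precompact families of functions. -/
def IsPointwisePrecompact {X Y : Type*} [TopologicalSpace Y] (F : Set (X → Y)) : Prop :=
  ∀ x : X, IsCompact (closure {y : Y | ∃ f ∈ F, f x = y})

/-- The symmetrized 2-hull of a family of functions. -/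
def symmetrizedTwoHull {X Y : Type*} (F : Set (X → Y)) : Set (X → Y) :=
  {g | ∀ x y : X, ∃ f ∈ F, ({g x, g y} : Set Y) = {f x, f y}}

/-- `D_K`: the members `h` of `G` for which `h(K)` meets `K`. -/
def returnSet {X : Type*} [TopologicalSpace X] (G : Subgroup (X ≃ₜ X)) (K : Set X) :
    Set (X ≃ₜ X) :=
  {h | h ∈ G ∧ (h '' K ∩ K).Nonempty}

open Filter

/-- A proper compatible metric on a topological space, as a function of two variables. -/
structure IsProperMetric {X : Type*} [TopologicalSpace X] (d : X → X → ℝ) : Prop where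
  self : ∀ x, d x x = 0
  comm : ∀ x y, d x y = d y x
  triangle : ∀ x y z, d x z ≤ d x y + d y z
  eq_of_eq_zero : ∀ x y, d x y = 0 → x = y
  continuous : Continuous fun p : X × X => d p.1 p.2
  isCompact_ball : ∀ x r, IsCompact {y | d x y ≤ r}

/-- Bijective isometries of a distance function. -/
def IsBijIsometry {X : Type*} (d : X → X → ℝ) (f : X → X) : Prop :=
  Function.Bijective f ∧ ∀ x y, d (f x) (f y) = d x y

theorem continuous_of_tendsto_zero {X : Type*} [TopologicalSpace X] {d : X → X → ℝ}
    (comm : ∀ x y, d x y = d y x) (triangle : ∀ x y z, d x z ≤ d x y + d y z)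
    (h : ∀ x, Tendsto (fun y => d x y) (𝓝 x) (𝓝 0)) :
    Continuous fun p : X × X => d p.1 p.2 := by
  rw [continuous_iff_continuousAt]
  rintro ⟨x, y⟩
  have h1 : Tendsto (fun p : X × X => d x p.1 + d y p.2) (𝓝 (x, y)) (𝓝 (0 + 0)) :=
    ((h x).comp continuous_fst.continuousAt.tendsto).add
      ((h y).comp continuous_snd.continuousAt.tendsto)
  rw [add_zero] at h1
  rw [ContinuousAt, tendsto_iff_dist_tendsto_zero]
  refine squeeze_zero (fun _ => dist_nonneg) (fun p => ?_) h1
  rw [Real.dist_eq, abs_sub_le_iff]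
  have e1 := triangle p.1 x p.2
  have e2 := triangle x y p.2
  have e3 := triangle x p.1 y
  have e4 := triangle p.1 p.2 y
  rw [comm p.1 x] at e1
  rw [comm p.2 y] at e4
  constructor <;> linarith

namespace IsProperMetric

variable {X : Type*} [TopologicalSpace X] {d : X → X → ℝ}

theorem nonneg (hd : IsProperMetric d) (x y : X) : 0 ≤ d x y := by
  have h := hd.triangle x y x
  rw [hd.self, hd.comm y x] at h
  linarith

theorem pos (hd : IsProperMetric d) {x y : X} (h : x ≠ y) : 0 < d x y :=
  (hd.nonneg x y).lt_of_ne fun h0 => h (hd.eq_of_eq_zero x y h0.symm)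

theorem continuous_right (hd : IsProperMetric d) (x : X) : Continuous (d x) :=
  hd.continuous.comp (Continuous.prodMk_right x)

theorem t2Space (hd : IsProperMetric d) : T2Space X := by
  refine ⟨fun x y hxy => ?_⟩
  have hp := hd.pos hxy
  refine ⟨{z | d x z < d x y / 2}, {z | d y z < d x y / 2},
    isOpen_lt (hd.continuous_right x) continuous_const,
    isOpen_lt (hd.continuous_right y) continuous_const, ?_, ?_, ?_⟩
  · simpa [hd.self] using hp
  · simpa [hd.self] using hp
  · rw [Set.disjoint_left]
    intro z hz hz'
    simp only [mem_ofPred_eq] at hz hz'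
    have := hd.triangle x z y
    rw [hd.comm z y] at this
    linarith

theorem tendsto_zero (hd : IsProperMetric d) (x : X) :
    Tendsto (fun y => d x y) (𝓝 x) (𝓝 0) := by
  simpa [hd.self] using (hd.continuous_right x).tendsto x

theorem exists_ball_subset (hd : IsProperMetric d) {x : X} {U : Set X} (hU : U ∈ 𝓝 x) :
    ∃ ε > 0, ∀ y, d x y < ε → y ∈ U := by
  obtain ⟨V, hVU, hV, hxV⟩ := mem_nhds_iff.1 hU
  have hc : IsCompact ({y | d x y ≤ 1} \ V) := (hd.isCompact_ball x 1).diff hV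
  rcases ({y | d x y ≤ 1} \ V).eq_empty_or_nonempty with he | hne
  · refine ⟨1, one_pos, fun y hy => hVU ?_⟩
    by_contra hyV
    exact (he ▸ (⟨hy.le, hyV⟩ : y ∈ {y | d x y ≤ 1} \ V) : y ∈ (∅ : Set X))
  · obtain ⟨z, hz, hmin⟩ := hc.exists_isMinOn hne (hd.continuous_right x).continuousOn
    have hz0 : 0 < d x z := hd.pos fun h => hz.2 (h ▸ hxV)
    refine ⟨min 1 (d x z), lt_min one_pos hz0, fun y hy => hVU ?_⟩
    by_contra hyV
    have : d x z ≤ d x y := hmin ⟨(hy.trans_le (min_le_left _ _)).le, hyV⟩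
    exact absurd (hy.trans_le (min_le_right _ _)) (not_lt.2 this)

theorem tendsto_of_tendsto_zero (hd : IsProperMetric d) {ι : Type*} {l : Filter ι} {u : ι → X}
    {x : X} (h : Tendsto (fun i => d x (u i)) l (𝓝 0)) : Tendsto u l (𝓝 x) := by
  intro U hU
  obtain ⟨ε, hε, hs⟩ := hd.exists_ball_subset hU
  filter_upwards [h.eventually_lt_const hε] with i hi using hs _ hi

theorem isOpen_iff (hd : IsProperMetric d) (s : Set X) :
    IsOpen s ↔ ∀ x ∈ s, ∃ ε > 0, ∀ y, d x y < ε → y ∈ s := by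
  rw [isOpen_iff_mem_nhds]
  refine forall₂_congr fun x _ => ⟨hd.exists_ball_subset, ?_⟩
  rintro ⟨ε, hε, h⟩
  exact mem_of_superset ((hd.tendsto_zero x).eventually_lt_const hε) h

theorem exists_metricSpace (hd : IsProperMetric d) :
    ∃ m ∈ properMetrics X, m.dist = d := by
  refine ⟨MetricSpace.ofDistTopology d hd.self hd.comm hd.triangle hd.isOpen_iff hd.eq_of_eq_zero,
    ⟨rfl, ?_⟩, rfl⟩
  let _ := MetricSpace.ofDistTopology d hd.self hd.comm hd.triangle hd.isOpen_iff hd.eq_of_eq_zero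
  refine ⟨fun x r => ?_⟩
  have : Metric.closedBall x r = {y | d x y ≤ r} := by
    ext y
    exact (show d y x ≤ r ↔ d x y ≤ r by rw [hd.comm])
  rw [this]
  exact hd.isCompact_ball x r

theorem of_mem_properMetrics {m : MetricSpace X} (hm : m ∈ properMetrics X) :
    IsProperMetric m.dist := by
  rename_i t
  obtain ⟨rfl, hp⟩ := hm
  exact
    { self := dist_self
      comm := dist_comm
      triangle := dist_triangle
      eq_of_eq_zero := fun _ _ => eq_of_dist_eq_zero
      continuous := continuous_dist
      isCompact_ball := fun x r => by
        have := isCompact_closedBall x r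
        convert this using 1
        ext y
        exact (show dist x y ≤ r ↔ dist y x ≤ r by rw [dist_comm]) }

theorem of_le_of_le (hd : IsProperMetric d) {ρ : X → X → ℝ} {C : ℝ}
    (comm : ∀ x y, ρ x y = ρ y x) (triangle : ∀ x y z, ρ x z ≤ ρ x y + ρ y z)
    (hle : ∀ x y, d x y ≤ ρ x y) (hge : ∀ x y, ρ x y ≤ C * d x y) : IsProperMetric ρ := by
  have self : ∀ x, ρ x x = 0 := fun x => by
    have h1 := hle x x
    have h2 := hge x x
    rw [hd.self] at h1 h2
    linarith
  have hcont : Continuous fun p : X × X => ρ p.1 p.2 := by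
    refine continuous_of_tendsto_zero comm triangle fun x => ?_
    have := (hd.tendsto_zero x).const_mul C
    rw [mul_zero] at this
    exact squeeze_zero (fun y => (hd.nonneg x y).trans (hle x y)) (fun y => hge x y) this
  refine ⟨self, comm, triangle, fun x y h => ?_, hcont, fun x r => ?_⟩
  · exact hd.eq_of_eq_zero x y (le_antisymm (h ▸ hle x y) (hd.nonneg x y))
  · exact (hd.isCompact_ball x r).of_isClosed_subset
      (isClosed_le (hcont.comp (Continuous.prodMk_right x)) continuous_const)
      fun y hy => (hle x y).trans hy

theorem exists_ultrafilter_limit (hd : IsProperMetric d) {ι : Type*} (𝒰 : Ultrafilter ι)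
    {f : ι → X → X} {x₀ : X} {R C : ℝ} (hR : ∀ i, d x₀ (f i x₀) ≤ R)
    (hf : ∀ i x y, d (f i x) (f i y) ≤ C * d x y) :
    ∃ F : X → X, ∀ x, Tendsto (fun i => f i x) 𝒰 (𝓝 (F x)) := by
  have : ∀ x, ∃ z, Tendsto (fun i => f i x) 𝒰 (𝓝 z) := by
    intro x
    obtain ⟨z, -, hz⟩ := (hd.isCompact_ball x₀ (R + C * d x₀ x)).ultrafilter_le_nhds
      (𝒰.map fun i => f i x) (by
        rw [le_principal_iff]
        refine Filter.Eventually.of_forall (f := (𝒰 : Filter ι)) fun i => ?_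
        show d x₀ (f i x) ≤ _
        have := hd.triangle x₀ (f i x₀) (f i x)
        linarith [hR i, hf i x₀ x])
    exact ⟨z, hz⟩
  exact ⟨fun x => (this x).choose, fun x => (this x).choose_spec⟩

/-- Bijective isometries for metrics converging to `d` converge to a bijective isometry
for `d` along any ultrafilter, provided that they do not escape to infinity. -/
theorem exists_limit_isometry (hd : IsProperMetric d) {ι : Type*} (𝒰 : Ultrafilter ι)
    {D : ι → X → X → ℝ} {e : ι → ℝ} (he : Tendsto e 𝒰 (𝓝 0)) (he1 : ∀ i, e i ≤ 1)
    (h1 : ∀ i x y, d x y ≤ D i x y) (h2 : ∀ i x y, D i x y ≤ (1 + e i) * d x y)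
    {f : ι → X → X} (hf : ∀ i, IsBijIsometry (D i) (f i)) {x₀ : X} {R : ℝ}
    (hR : ∀ i, d x₀ (f i x₀) ≤ R) :
    ∃ F : X → X, IsBijIsometry d F ∧ ∀ x, Tendsto (fun i => f i x) 𝒰 (𝓝 (F x)) := by
  have h2' : ∀ i x y, D i x y ≤ 2 * d x y := fun i x y =>
    (h2 i x y).trans (mul_le_mul_of_nonneg_right (by linarith [he1 i]) (hd.nonneg x y))
  have hlip : ∀ i x y, d (f i x) (f i y) ≤ 2 * d x y := fun i x y =>
    (h1 i _ _).trans (((hf i).2 x y).le.trans (h2' i x y))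
  choose h hh using fun i => (hf i).1.2
  have hlip' : ∀ i x y, d (h i x) (h i y) ≤ 2 * d x y := fun i x y => by
    refine (h1 i _ _).trans ?_
    rw [← (hf i).2, hh, hh]
    exact h2' i x y
  have hR' : ∀ i, d x₀ (h i x₀) ≤ 2 * R := fun i => by
    refine (h1 i _ _).trans ?_
    rw [← (hf i).2, hh]
    have := h2' i (f i x₀) x₀
    rw [hd.comm] at this
    linarith [hR i]
  obtain ⟨F, hF⟩ := hd.exists_ultrafilter_limit 𝒰 hR hlip
  obtain ⟨H, hH⟩ := hd.exists_ultrafilter_limit 𝒰 hR' hlip'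
  have hD : ∀ x y, Tendsto (fun i => D i x y) 𝒰 (𝓝 (d x y)) := fun x y => by
    refine tendsto_of_tendsto_of_tendsto_of_le_of_le tendsto_const_nhds
      (h := fun i => (1 + e i) * d x y) ?_ (fun i => h1 i x y) (fun i => h2 i x y)
    simpa using (he.const_add 1).mul_const (d x y)
  have hiso : ∀ x y, d (F x) (F y) = d x y := fun x y => by
    have hlim : Tendsto (fun i => d (f i x) (f i y)) 𝒰 (𝓝 (d (F x) (F y))) :=
      (hd.continuous.tendsto (F x, F y)).comp ((hF x).prodMk_nhds (hF y))
    refine le_antisymm (le_of_tendsto_of_tendsto hlim (hD x y) (Eventually.of_forall fun i =>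
      (h1 i _ _).trans ((hf i).2 x y).le)) ?_
    refine le_of_tendsto_of_tendsto (hD x y)
      (g := fun i => (1 + e i) * d (f i x) (f i y)) ?_ (Eventually.of_forall fun i => ?_)
    · simpa using (he.const_add 1).mul hlim
    · exact ((hf i).2 x y).ge.trans (h2 i _ _)
  refine ⟨F, ⟨⟨fun x y hxy => hd.eq_of_eq_zero x y ?_, fun y => ⟨H y, ?_⟩⟩, hiso⟩, hF⟩
  · rw [← hiso, hxy, hd.self]
  · have h3 : Tendsto (fun i => 2 * d (H y) (h i y)) 𝒰 (𝓝 0) := by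
      have := (((hd.tendsto_zero (H y)).comp (hH y)).const_mul 2)
      simpa using this
    have h4 : Tendsto (fun i => f i (H y)) 𝒰 (𝓝 y) := by
      refine hd.tendsto_of_tendsto_zero (squeeze_zero (fun i => hd.nonneg _ _) (fun i => ?_) h3)
      have := hlip i (h i y) (H y)
      rwa [hh, hd.comm (h i y)] at this
    have := hd.t2Space
    exact tendsto_nhds_unique (hF (H y)) h4

end IsProperMetric

theorem countable_values_isLocalMax {Y : Type*} [TopologicalSpace Y] [SecondCountableTopology Y]
    (h : Y → ℝ) : {c | ∃ p, IsLocalMax h p ∧ h p = c}.Countable := by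
  have hb := TopologicalSpace.isBasis_countableBasis Y
  refine ((TopologicalSpace.countable_countableBasis Y).image fun B => sSup (h '' B)).mono ?_
  rintro c ⟨p, hp, rfl⟩
  obtain ⟨B, hB, hpB, hBs⟩ := hb.mem_nhds_iff.1 hp
  refine ⟨B, hB, IsGreatest.csSup_eq ⟨mem_image_of_mem h hpB, ?_⟩⟩
  rintro _ ⟨q, hq, rfl⟩
  exact hBs hq

theorem IsProperMetric.continuous_of_isometry {X : Type*} [TopologicalSpace X] {d : X → X → ℝ}
    (hd : IsProperMetric d) {f : X → X} (hf : ∀ x y, d (f x) (f y) = d x y) : Continuous f := by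
  rw [continuous_iff_continuousAt]
  intro x
  refine hd.tendsto_of_tendsto_zero ?_
  simpa only [hf] using hd.tendsto_zero x

theorem IsProperMetric.exists_homeomorph {X : Type*} [TopologicalSpace X] {d : X → X → ℝ}
    (hd : IsProperMetric d) {f : X → X} (hf : IsBijIsometry d f) : ∃ e : X ≃ₜ X, ⇑e = f := by
  obtain ⟨hb, hi⟩ := hf
  refine ⟨⟨Equiv.ofBijective f hb, hd.continuous_of_isometry hi,
    hd.continuous_of_isometry fun x y => ?_⟩, rfl⟩
  have hs : ∀ z, f ((Equiv.ofBijective f hb).symm z) = z :=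
    (Equiv.ofBijective f hb).apply_symm_apply
  have h := hi ((Equiv.ofBijective f hb).symm x) ((Equiv.ofBijective f hb).symm y)
  rw [hs, hs] at h
  exact h.symm

section Spike

variable {X : Type*} {d : X → X → ℝ} {P : Set (X × X)}

/-- The `ℓ¹`-distance of the pair `(x, y)` to a set of pairs. -/
noncomputable def pairDist (d : X → X → ℝ) (P : Set (X × X)) (x y : X) : ℝ :=
  ⨅ p : P, (d x p.1.1 + d y p.1.2)

/-- The metric obtained by raising `d + η * min d t` near the pairs from `P` to the level `v`. -/
noncomputable def spike (d : X → X → ℝ) (η t v : ℝ) (P : Set (X × X)) (x y : X) : ℝ :=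
  max (d x y + η * min (d x y) t) (v - (1 + η) * pairDist d P x y)

theorem le_pairDist (hP : P.Nonempty) {x y : X} {c : ℝ}
    (h : ∀ p ∈ P, c ≤ d x p.1 + d y p.2) : c ≤ pairDist d P x y := by
  have := hP.to_subtype
  exact le_ciInf fun p => h p.1 p.2

theorem exists_of_pairDist_lt (hP : P.Nonempty) {x y : X} {c : ℝ} (h : pairDist d P x y < c) :
    ∃ p ∈ P, d x p.1 + d y p.2 < c := by
  by_contra! hc
  exact absurd h (not_lt.2 (le_pairDist hP hc))

variable [TopologicalSpace X]

theorem bddBelow_pairDist (hd : IsProperMetric d) (x y : X) :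
    BddBelow (range fun p : P => d x p.1.1 + d y p.1.2) := by
  refine ⟨0, ?_⟩
  rintro _ ⟨p, rfl⟩
  exact add_nonneg (hd.nonneg _ _) (hd.nonneg _ _)

theorem pairDist_nonneg (hd : IsProperMetric d) (x y : X) : 0 ≤ pairDist d P x y :=
  Real.iInf_nonneg fun _ => add_nonneg (hd.nonneg _ _) (hd.nonneg _ _)

theorem pairDist_le (hd : IsProperMetric d) (x y : X) {p : X × X} (hp : p ∈ P) :
    pairDist d P x y ≤ d x p.1 + d y p.2 :=
  ciInf_le (bddBelow_pairDist hd x y) (⟨p, hp⟩ : P)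

theorem pairDist_comm (hd : IsProperMetric d) (hP : P.Nonempty) (hs : ∀ p ∈ P, p.swap ∈ P)
    (x y : X) : pairDist d P x y = pairDist d P y x := by
  have : ∀ x y, pairDist d P x y ≤ pairDist d P y x := fun x y =>
    le_pairDist hP fun p hp => (pairDist_le hd x y (hs p hp)).trans_eq (add_comm _ _)
  exact le_antisymm (this x y) (this y x)

theorem pairDist_le_add (hd : IsProperMetric d) (hP : P.Nonempty) (x y z : X) :
    pairDist d P x y ≤ pairDist d P x z + d y z := by
  rw [← sub_le_iff_le_add]
  refine le_pairDist hP fun p hp => ?_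
  linarith [pairDist_le hd x y hp, hd.triangle y z p.2]

theorem le_add_pairDist (hd : IsProperMetric d) (hP : P.Nonempty) {l : ℝ}
    (hl : ∀ p ∈ P, d p.1 p.2 = l) (x y : X) : l ≤ d x y + pairDist d P x y := by
  rw [← sub_le_iff_le_add']
  refine le_pairDist hP fun p hp => ?_
  have h1 := hd.triangle p.1 x p.2
  have h2 := hd.triangle x y p.2
  rw [hl p hp, hd.comm p.1 x] at h1
  linarith

theorem le_spike {η t : ℝ} (hη : 0 < η) (ht : 0 < t) (hd : IsProperMetric d) (v : ℝ) (x y : X) :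
    d x y ≤ spike d η t v P x y := by
  refine le_trans ?_ (le_max_left _ _)
  have := mul_nonneg hη.le (le_min (hd.nonneg x y) ht.le)
  linarith

theorem spike_le {η t τ l : ℝ} (hη : 0 < η) (hτt : τ ≤ η * t) (hd : IsProperMetric d)
    (hP : P.Nonempty) (hl : ∀ p ∈ P, d p.1 p.2 = l) (hlt : 2 * t ≤ l) (x y : X) :
    spike d η t (l + η * t + τ) P x y ≤ (1 + 2 * η) * d x y := by
  have h0 := hd.nonneg x y
  have hm : η * min (d x y) t ≤ η * d x y := mul_le_mul_of_nonneg_left (min_le_left _ _) hη.le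
  have h1 := le_add_pairDist hd hP hl x y
  have h2 := pairDist_nonneg (P := P) hd x y
  have h3 : 0 ≤ η * d x y := by positivity
  refine max_le (by linarith) ?_
  rcases le_total t (d x y) with h | h
  · have := mul_le_mul_of_nonneg_left h hη.le
    have := mul_nonneg hη.le h2
    linarith
  · have : η * l ≤ η * (d x y + pairDist d P x y) := mul_le_mul_of_nonneg_left h1 hη.le
    have : η * (2 * t) ≤ η * l := mul_le_mul_of_nonneg_left hlt hη.le
    linarith

theorem spike_triangle {η t τ l : ℝ} (hη : 0 < η) (ht : 0 < t) (hτt : τ ≤ η * t)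
    (hd : IsProperMetric d) (hP : P.Nonempty) (hs : ∀ p ∈ P, p.swap ∈ P)
    (hl : ∀ p ∈ P, d p.1 p.2 = l) (x y z : X) :
    spike d η t (l + η * t + τ) P x z ≤
      spike d η t (l + η * t + τ) P x y + spike d η t (l + η * t + τ) P y z := by
  have hxy := hd.nonneg x y
  have hyz := hd.nonneg y z
  have htri := hd.triangle x y z
  set v := l + η * t + τ
  have ha : d x y + η * min (d x y) t ≤ spike d η t v P x y := le_max_left _ _
  have hb : d y z + η * min (d y z) t ≤ spike d η t v P y z := le_max_left _ _
  have ha' : v - (1 + η) * pairDist d P x y ≤ spike d η t v P x y := le_max_right _ _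
  have hb' : v - (1 + η) * pairDist d P y z ≤ spike d η t v P y z := le_max_right _ _
  refine max_le ?_ ?_
  · have : min (d x z) t ≤ min (d x y) t + min (d y z) t := by
      rcases le_total (d x y) t with h | h <;> rcases le_total (d y z) t with h' | h' <;>
        simp only [h, h', min_eq_left, min_eq_right]
      · exact (min_le_left _ _).trans htri
      · exact (min_le_right _ _).trans (by linarith)
      · exact (min_le_right _ _).trans (by linarith)
      · exact (min_le_right _ _).trans (by linarith)
    have := mul_le_mul_of_nonneg_left this hη.le
    linarith
  · have hη1 : 0 ≤ 1 + η := by linarith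
    rcases le_total (d y z) t with h | h
    · have := mul_le_mul_of_nonneg_left (pairDist_le_add hd hP x y z) hη1
      rw [min_eq_left h] at hb
      linarith
    rcases le_total (d x y) t with h' | h'
    · have := pairDist_le_add hd hP z y x
      rw [pairDist_comm hd hP hs z y, pairDist_comm hd hP hs z x, hd.comm y x] at this
      have := mul_le_mul_of_nonneg_left this hη1
      rw [min_eq_left h'] at ha
      linarith
    · rw [min_eq_right h] at hb
      rw [min_eq_right h'] at ha
      have h1 := le_add_pairDist hd hP hl x z
      have h2 := mul_nonneg hη.le (pairDist_nonneg (P := P) hd x z)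
      have : v = l + η * t + τ := rfl
      linarith

end Spike

/-- A slight increase of an invariant proper metric makes all its isometries preserve
approximately the orbit of a given unordered pair. -/
theorem exists_metric_isometry_pair {X : Type*} [TopologicalSpace X] [SecondCountableTopology X]
    {d : X → X → ℝ} (hd : IsProperMetric d) (G : Subgroup (X ≃ₜ X))
    (hG : ∀ g ∈ G, ∀ x y, d (g x) (g y) = d x y) {a b : X} (hab : a ≠ b) {η : ℝ} (hη : 0 < η) :
    ∃ ρ : X → X → ℝ, IsProperMetric ρ ∧ (∀ g ∈ G, ∀ x y, ρ (g x) (g y) = ρ x y) ∧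
      (∀ x y, d x y ≤ ρ x y) ∧ (∀ x y, ρ x y ≤ (1 + 2 * η) * d x y) ∧
      ∀ f, IsBijIsometry ρ f → ∀ r > 0, ∃ g ∈ G, (d (f a) (g a) < r ∧ d (f b) (g b) < r) ∨
        (d (f a) (g b) < r ∧ d (f b) (g a) < r) := by
  set l := d a b
  have hl0 : 0 < l := hd.pos hab
  set t := l / 2
  have ht : 0 < t := half_pos hl0
  set P : Set (X × X) := {p | ∃ g ∈ G, p = (g a, g b) ∨ p = (g b, g a)}
  have habP : (a, b) ∈ P := ⟨1, G.one_mem, Or.inl rfl⟩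
  have hP : P.Nonempty := ⟨_, habP⟩
  have hs : ∀ p ∈ P, p.swap ∈ P := by
    rintro _ ⟨g, hg, rfl | rfl⟩
    exacts [⟨g, hg, Or.inr rfl⟩, ⟨g, hg, Or.inl rfl⟩]
  have hl : ∀ p ∈ P, d p.1 p.2 = l := by
    rintro _ ⟨g, hg, rfl | rfl⟩
    exacts [hG g hg a b, (hG g hg b a).trans (hd.comm b a)]
  set ρ₀ : X × X → ℝ := fun p => d p.1 p.2 + η * min (d p.1 p.2) t
  obtain ⟨v, hvS, hv1, hv2⟩ : ∃ v, v ∈ {c | ∃ p, IsLocalMax ρ₀ p ∧ ρ₀ p = c}ᶜ ∧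
      l + η * t < v ∧ v < l + η * t + η * t := by
    obtain ⟨v, hv, h⟩ := ((countable_values_isLocalMax ρ₀).dense_compl ℝ).exists_mem_open
      (isOpen_Ioo (a := l + η * t) (b := l + η * t + η * t))
      (nonempty_Ioo.2 (by linarith [mul_pos hη ht]))
    exact ⟨v, hv, h.1, h.2⟩
  obtain ⟨τ, rfl⟩ : ∃ τ, v = l + η * t + τ := ⟨v - (l + η * t), by ring⟩
  have hτ : τ ≤ η * t := by linarith
  set ρ := spike d η t (l + η * t + τ) P
  have hlt : 2 * t ≤ l := by simp [t]; linarith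
  have hle : ∀ x y, d x y ≤ ρ x y := le_spike hη ht hd _
  have hge : ∀ x y, ρ x y ≤ (1 + 2 * η) * d x y := spike_le hη hτ hd hP hl hlt
  have hρ : IsProperMetric ρ := hd.of_le_of_le
    (fun x y => by simp only [ρ, spike, hd.comm x y, pairDist_comm hd hP hs x y])
    (spike_triangle hη ht hτ hd hP hs hl) hle hge
  have hinv : ∀ g ∈ G, ∀ x y, pairDist d P x y ≤ pairDist d P (g x) (g y) := by
    intro g hg x y
    refine le_pairDist hP fun p hp => ?_
    obtain ⟨h, hh, hp⟩ := hp
    have hp' : (g⁻¹ p.1, g⁻¹ p.2) ∈ P := by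
      refine ⟨g⁻¹ * h, G.mul_mem (G.inv_mem hg) hh, ?_⟩
      rcases hp with rfl | rfl
      exacts [Or.inl rfl, Or.inr rfl]
    refine (pairDist_le hd x y hp').trans_eq ?_
    rw [← hG g hg x, ← hG g hg y]
    simp
  refine ⟨ρ, hρ, fun g hg x y => ?_, hle, hge, fun f hf r hr => ?_⟩
  · have h1 := hinv g⁻¹ (G.inv_mem hg) (g x) (g y)
    simp only [Homeomorph.inv_apply, Homeomorph.symm_apply_apply] at h1
    simp only [ρ, spike, hG g hg, le_antisymm h1 (hinv g hg x y)]
  · have hρ₀ : Continuous ρ₀ :=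
      hd.continuous.add (continuous_const.mul (hd.continuous.min continuous_const))
    have hpd0 : pairDist d P a b = 0 :=
      le_antisymm ((pairDist_le hd a b habP).trans_eq (by simp [hd.self]))
        (pairDist_nonneg hd a b)
    have hρ₀ab : ρ₀ (a, b) = l + η * t := by
      simp only [ρ₀]
      rw [min_eq_right (by linarith)]
    have hρab : ρ a b = l + η * t + τ := by
      have h1 : ρ a b = max (ρ₀ (a, b)) _ := rfl
      rw [h1, hpd0, hρ₀ab, mul_zero, sub_zero, max_eq_right hv1.le]
    have hmax : ∀ᶠ p in 𝓝 (a, b), ρ p.1 p.2 ≤ l + η * t + τ := by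
      filter_upwards [hρ₀.continuousAt.eventually_lt_const (hρ₀ab.trans_lt hv1)] with p hp
      refine max_le hp.le ?_
      have := mul_nonneg (by linarith : 0 ≤ 1 + η) (pairDist_nonneg (P := P) hd p.1 p.2)
      linarith
    obtain ⟨e, rfl⟩ := hρ.exists_homeomorph hf
    have hmax' : ∀ᶠ p in 𝓝 (e a, e b), ρ p.1 p.2 ≤ l + η * t + τ := by
      have h1 : Tendsto (fun p : X × X => (e.symm p.1, e.symm p.2)) (𝓝 (e a, e b))
          (𝓝 (a, b)) := by
        have : Continuous fun p : X × X => (e.symm p.1, e.symm p.2) := by fun_prop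
        simpa using this.tendsto (e a, e b)
      filter_upwards [h1.eventually hmax] with p hp
      have := hf.2 (e.symm p.1) (e.symm p.2)
      simp only [Homeomorph.apply_symm_apply] at this
      exact this.trans_le hp
    have hval : ρ (e a) (e b) = l + η * t + τ := (hf.2 a b).trans hρab
    have hD : pairDist d P (e a) (e b) = 0 := by
      by_contra hne
      have hpos := (pairDist_nonneg (P := P) hd (e a) (e b)).lt_of_ne' hne
      have hρ₀e : ρ₀ (e a, e b) = l + η * t + τ := by
        have h1 : max (ρ₀ (e a, e b)) (l + η * t + τ - (1 + η) * pairDist d P (e a) (e b)) =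
          l + η * t + τ := hval
        rcases max_eq_iff.1 h1 with h | h
        · exact h.1
        · have := mul_pos (by linarith : 0 < 1 + η) hpos
          linarith [h.1]
      refine hvS ⟨(e a, e b), ?_, hρ₀e⟩
      filter_upwards [hmax'] with p hp
      rw [hρ₀e]
      exact (le_max_left _ _).trans hp
    obtain ⟨p, ⟨g, hg, hp⟩, hpr⟩ := exists_of_pairDist_lt hP (hD.trans_lt hr)
    have h1 := hd.nonneg (e a) p.1
    have h2 := hd.nonneg (e b) p.2
    refine ⟨g, hg, ?_⟩
    rcases hp with rfl | rfl
    · exact Or.inl ⟨by linarith, by linarith⟩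
    · exact Or.inr ⟨by linarith, by linarith⟩

section Approximation

variable {X : Type*} [TopologicalSpace X]

/-- The map `f` sends the unordered pair `{a, b}` to within `r` of its `G`-orbit. -/
def PairClose (d : X → X → ℝ) (G : Subgroup (X ≃ₜ X)) (f : X → X) (a b : X) (r : ℝ) : Prop :=
  ∃ g ∈ G, (d (f a) (g a) < r ∧ d (f b) (g b) < r) ∨ (d (f a) (g b) < r ∧ d (f b) (g a) < r)

theorem PairClose.mono {d : X → X → ℝ} {G : Subgroup (X ≃ₜ X)} {f : X → X} {a b : X} {r s : ℝ}
    (h : PairClose d G f a b r) (hrs : r ≤ s) : PairClose d G f a b s := by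
  obtain ⟨g, hg, h⟩ := h
  exact ⟨g, hg, h.imp (fun h => ⟨h.1.trans_le hrs, h.2.trans_le hrs⟩)
    fun h => ⟨h.1.trans_le hrs, h.2.trans_le hrs⟩⟩

theorem eventually_pairClose {d : X → X → ℝ} (hd : IsProperMetric d) {G : Subgroup (X ≃ₜ X)}
    {ι : Type*} {l : Filter ι} {f : ι → X → X} {F : X → X}
    (hF : ∀ x, Tendsto (fun i => f i x) l (𝓝 (F x))) {a b : X} {r : ℝ}
    (h : PairClose d G F a b r) : ∀ᶠ i in l, PairClose d G (f i) a b r := by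
  have key : ∀ x y, d (F x) y < r → ∀ᶠ i in l, d (f i x) y < r := fun x y hxy =>
    (((hd.continuous.comp (Continuous.prodMk_left y)).tendsto (F x)).comp
      (hF x)).eventually_lt_const hxy
  obtain ⟨g, hg, h | h⟩ := h
  · filter_upwards [key _ _ h.1, key _ _ h.2] with i h1 h2 using ⟨g, hg, Or.inl ⟨h1, h2⟩⟩
  · filter_upwards [key _ _ h.1, key _ _ h.2] with i h1 h2 using ⟨g, hg, Or.inr ⟨h1, h2⟩⟩

theorem exists_stable_metric_isometry_pair [SecondCountableTopology X] {d ρ : X → X → ℝ}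
    (hd : IsProperMetric d) (hρ : IsProperMetric ρ) (hdρ : ∀ x y, d x y ≤ ρ x y)
    (G : Subgroup (X ≃ₜ X)) (hG : ∀ g ∈ G, ∀ x y, ρ (g x) (g y) = ρ x y) {a b : X} (hab : a ≠ b)
    {β : ℝ} (hβ : 0 < β) (x₀ : X) (R : ℝ) {r : ℝ} (hr : 0 < r) :
    ∃ (ρ' : X → X → ℝ) (β' : ℝ), IsProperMetric ρ' ∧
      (∀ g ∈ G, ∀ x y, ρ' (g x) (g y) = ρ' x y) ∧ 0 < β' ∧ (∀ x y, ρ x y ≤ ρ' x y) ∧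
      (∀ x y, (1 + β') * ρ' x y ≤ (1 + β) * ρ x y) ∧
      ∀ σ : X → X → ℝ, (∀ x y, ρ' x y ≤ σ x y) →
        (∀ x y, σ x y ≤ (1 + β') * ρ' x y) → ∀ f, IsBijIsometry σ f → σ x₀ (f x₀) ≤ R →
          PairClose d G f a b r := by
  obtain ⟨ρ', hρ', hG', hle, hge, hiso⟩ :=
    exists_metric_isometry_pair hρ G hG hab (η := β / 4) (by positivity)
  set c := min 1 (β / (2 + β))
  have hc : 0 < c := lt_min one_pos (by positivity)
  have hcn : ∀ n : ℕ, 0 < c / (n + 1) ∧ c / (n + 1) ≤ c := fun n =>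
    ⟨by positivity, div_le_self hc.le (by linarith [(Nat.cast_nonneg n : (0 : ℝ) ≤ n)])⟩
  have hcβ : (1 + c) * (1 + 2 * (β / 4)) ≤ 1 + β := by
    have h1 : c ≤ β / (2 + β) := min_le_right _ _
    rw [le_div_iff₀ (by positivity)] at h1
    linarith
  by_contra! hcon
  have hcon' : ∀ n : ℕ, ∃ σ : X → X → ℝ, (∀ x y, ρ' x y ≤ σ x y) ∧
      (∀ x y, σ x y ≤ (1 + c / (n + 1)) * ρ' x y) ∧ ∃ f, IsBijIsometry σ f ∧ σ x₀ (f x₀) ≤ R ∧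
        ¬ PairClose d G f a b r := fun n => by
    refine hcon ρ' (c / (n + 1)) hρ' hG' (hcn n).1 hle fun x y => ?_
    calc (1 + c / (n + 1)) * ρ' x y ≤ (1 + c) * ρ' x y :=
          mul_le_mul_of_nonneg_right (by linarith [(hcn n).2]) (hρ'.nonneg x y)
      _ ≤ (1 + c) * ((1 + 2 * (β / 4)) * ρ x y) :=
          mul_le_mul_of_nonneg_left (hge x y) (by positivity)
      _ = ((1 + c) * (1 + 2 * (β / 4))) * ρ x y := by ring
      _ ≤ (1 + β) * ρ x y := mul_le_mul_of_nonneg_right hcβ (hρ.nonneg x y)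
  choose σ hσ1 hσ2 f hf hR hnot using hcon'
  have he : Tendsto (fun n : ℕ => c / ((n : ℝ) + 1)) (hyperfilter ℕ) (𝓝 0) := by
    have h1 : Tendsto (fun n : ℕ => c * (1 / ((n : ℝ) + 1))) atTop (𝓝 (c * 0)) :=
      tendsto_one_div_add_atTop_nhds_zero_nat.const_mul c
    simp only [mul_zero, mul_one_div] at h1
    exact h1.mono_left Nat.hyperfilter_le_atTop
  obtain ⟨F, hF, hlim⟩ := hρ'.exists_limit_isometry (hyperfilter ℕ) he
    (fun n => (hcn n).2.trans (min_le_left _ _)) hσ1 hσ2 hf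
    (fun n => (hσ1 n _ _).trans (hR n))
  have hclose : PairClose d G F a b r := by
    obtain ⟨g, hg, h⟩ := hiso F hF r hr
    exact ⟨g, hg, h.imp
      (fun h => ⟨(hdρ _ _).trans_lt h.1, (hdρ _ _).trans_lt h.2⟩)
      fun h => ⟨(hdρ _ _).trans_lt h.1, (hdρ _ _).trans_lt h.2⟩⟩
  obtain ⟨n, hn⟩ := (eventually_pairClose hd hlim hclose).exists
  exact hnot n hn

theorem exists_metric_isometry_pairs [SecondCountableTopology X] {d : X → X → ℝ}
    (hd : IsProperMetric d) (G : Subgroup (X ≃ₜ X))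
    (hG : ∀ g ∈ G, ∀ x y, d (g x) (g y) = d x y) (x₀ : X) (u : ℕ → X × X)
    (hu : ∀ i, (u i).1 ≠ (u i).2) {ε : ℝ} (hε : 0 < ε) :
    ∃ ρ : X → X → ℝ, IsProperMetric ρ ∧ (∀ g ∈ G, ∀ x y, ρ (g x) (g y) = ρ x y) ∧
      (∀ x y, d x y ≤ ρ x y) ∧ (∀ x y, ρ x y ≤ (1 + ε) * d x y) ∧
      ∀ f, IsBijIsometry ρ f → ∀ i, ∀ r > 0, PairClose d G f (u i).1 (u i).2 r := by
  let S := {s : (X → X → ℝ) × ℝ // IsProperMetric s.1 ∧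
    (∀ g ∈ G, ∀ x y, s.1 (g x) (g y) = s.1 x y) ∧ 0 < s.2 ∧ ∀ x y, d x y ≤ s.1 x y}
  have step : ∀ (n : ℕ) (s : S), ∃ s' : S, (∀ x y, s.1.1 x y ≤ s'.1.1 x y) ∧
      (∀ x y, (1 + s'.1.2) * s'.1.1 x y ≤ (1 + s.1.2) * s.1.1 x y) ∧
      ∀ σ : X → X → ℝ, (∀ x y, s'.1.1 x y ≤ σ x y) →
        (∀ x y, σ x y ≤ (1 + s'.1.2) * s'.1.1 x y) → ∀ f, IsBijIsometry σ f →
          σ x₀ (f x₀) ≤ n →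
          PairClose d G f (u n.unpair.1).1 (u n.unpair.1).2 (1 / ((n : ℝ) + 1)) := by
    rintro n ⟨⟨ρ, β⟩, hρ, hρG, hβ, hdρ⟩
    obtain ⟨ρ', β', h1, h2, h3, h4, h5, h6⟩ := exists_stable_metric_isometry_pair hd hρ hdρ G hρG
      (hu n.unpair.1) hβ x₀ n (r := 1 / ((n : ℝ) + 1)) (by positivity)
    exact ⟨⟨⟨ρ', β'⟩, h1, h2, h3, fun x y => (hdρ x y).trans (h4 x y)⟩, h4, h5, h6⟩
  choose next hn1 hn2 hn3 using step
  let s : ℕ → S := fun n => Nat.rec ⟨⟨d, ε⟩, hd, hG, hε, fun _ _ => le_rfl⟩ next n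
  have hs : ∀ n, s (n + 1) = next n (s n) := fun n => rfl
  set ρ : X → X → ℝ := fun x y => ⨆ n, (s n).1.1 x y
  have hmem : ∀ n x y, (s n).1.1 x y ≤ ρ x y ∧ ρ x y ≤ (1 + (s n).1.2) * (s n).1.1 x y := by
    intro n x y
    have h1 : Monotone fun n => (s n).1.1 x y := monotone_nat_of_le_succ fun n => by
      rw [hs]
      exact hn1 n (s n) x y
    have h2 : Antitone fun n => (1 + (s n).1.2) * (s n).1.1 x y :=
      antitone_nat_of_succ_le fun n => by
        simp only [hs]
        exact hn2 n (s n) x y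
    have h3 := h1.ciSup_mem_iInter_Icc_of_antitone h2 fun n => by
      have h4 := (s n).2.2.2.1
      have h5 := (s n).2.1.nonneg x y
      nlinarith
    exact mem_iInter.1 h3 n
  have h0 : ∀ x y, d x y ≤ ρ x y ∧ ρ x y ≤ (1 + ε) * d x y := hmem 0
  refine ⟨ρ, hd.of_le_of_le (C := 1 + ε) (fun x y => ?_) (fun x y z => ?_)
    (fun x y => (h0 x y).1) (fun x y => (h0 x y).2), fun g hg x y => ?_, fun x y => (h0 x y).1,
    fun x y => (h0 x y).2, fun f hf i r hr => ?_⟩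
  · exact iSup_congr fun n => (s n).2.1.comm x y
  · exact ciSup_le fun n => ((s n).2.1.triangle x y z).trans
      (add_le_add (hmem n x y).1 (hmem n y z).1)
  · exact iSup_congr fun n => (s n).2.2.1 g hg x y
  · obtain ⟨m, hm⟩ := exists_nat_gt (max (ρ x₀ (f x₀)) (1 / r))
    have hmn : (m : ℝ) ≤ (Nat.pair i m : ℕ) := Nat.cast_le.2 (Nat.right_le_pair i m)
    have h1 := hn3 (Nat.pair i m) (s (Nat.pair i m)) ρ (fun x y => ?_) (fun x y => ?_) f hf ?_
    · rw [Nat.unpair_pair] at h1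
      refine h1.mono ?_
      rw [one_div_le (by positivity) hr]
      linarith [(le_max_right (ρ x₀ (f x₀)) (1 / r))]
    · rw [← hs]
      exact (hmem (Nat.pair i m + 1) x y).1
    · rw [← hs]
      exact (hmem (Nat.pair i m + 1) x y).2
    · linarith [(le_max_left (ρ x₀ (f x₀)) (1 / r))]

theorem exists_mem_of_tendsto {d : X → X → ℝ} (hd : IsProperMetric d) {G : Subgroup (X ≃ₜ X)}
    (hG : ∀ g ∈ G, ∀ x y, d (g x) (g y) = d x y)
    (hcl : IsClosed (underlyingContinuousMaps (G : Set (X ≃ₜ X)))) {ι : Type*} {l : Filter ι}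
    [l.NeBot] {g : ι → X ≃ₜ X} (hg : ∀ i, g i ∈ G) {F : X → X} (hF : Continuous F)
    (hlim : ∀ x, Tendsto (fun i => g i x) l (𝓝 (F x))) : ∃ h ∈ G, (h : X → X) = F := by
  have key : Tendsto (fun i => (⟨g i, (g i).continuous⟩ : C(X, X))) l (𝓝 ⟨F, hF⟩) := by
    rw [ContinuousMap.tendsto_nhds_compactOpen]
    intro K hK U hU hKU
    have : ∀ᶠ i in l, ∀ x ∈ K, g i x ∈ U := by
      refine hK.induction_on (p := fun S => ∀ᶠ i in l, ∀ x ∈ S, g i x ∈ U) (by simp)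
        (fun s t hst h => h.mono fun i hi x hx => hi x (hst hx)) (fun s t hs ht => ?_) ?_
      · filter_upwards [hs, ht] with i h1 h2 x hx using hx.elim (h1 x) (h2 x)
      · intro x hx
        obtain ⟨ε, hε, hs⟩ := hd.exists_ball_subset (hU.mem_nhds (hKU hx))
        refine ⟨{y | d x y < ε / 2}, mem_nhdsWithin_of_mem_nhds
          ((hd.tendsto_zero x).eventually_lt_const (half_pos hε)), ?_⟩
        filter_upwards [((hd.tendsto_zero (F x)).comp (hlim x)).eventually_lt_const
          (half_pos hε)] with i hi y hy
        refine hs _ (show d (F x) (g i y) < ε from ?_)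
        have h1 := hd.triangle (F x) (g i x) (g i y)
        rw [hG _ (hg i)] at h1
        change d x y < ε / 2 at hy
        simp only [Function.comp_apply] at hi
        linarith
    exact this
  obtain ⟨h, hh, he⟩ := hcl.mem_of_tendsto key (Eventually.of_forall fun i => ⟨g i, hg i, rfl⟩)
  exact ⟨h, hh, congrArg (fun c : C(X, X) => (c : X → X)) he⟩

theorem exists_mem_pair_of_pairClose {d : X → X → ℝ} (hd : IsProperMetric d)
    {G : Subgroup (X ≃ₜ X)} (hG : ∀ g ∈ G, ∀ x y, d (g x) (g y) = d x y)
    (hcl : IsClosed (underlyingContinuousMaps (G : Set (X ≃ₜ X)))) {f : X → X} {x y : X}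
    (h : ∀ r > 0, PairClose d G f x y r) :
    ∃ g ∈ G, (f x = g x ∧ f y = g y) ∨ (f x = g y ∧ f y = g x) := by
  have h' : ∀ n : ℕ, PairClose d G f x y (1 / ((n : ℝ) + 1)) := fun n => h _ (by positivity)
  choose g hg hclose using h'
  have hn1 : ∀ n : ℕ, 1 / ((n : ℝ) + 1) ≤ 1 := fun n => by
    rw [div_le_one (by positivity)]
    linarith [(Nat.cast_nonneg n : (0 : ℝ) ≤ n)]
  obtain ⟨F, hF, hlim⟩ := hd.exists_limit_isometry (hyperfilter ℕ) (D := fun _ => d)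
    (e := fun _ => 0) tendsto_const_nhds (fun _ => zero_le_one) (fun _ _ _ => le_rfl)
    (fun _ _ _ => by simp) (f := fun n => g n) (fun n => ⟨(g n).bijective, hG _ (hg n)⟩)
    (x₀ := x) (R := d x (f x) + d x (f y) + 1) (fun n => by
      have h1 := hd.triangle x (f x) (g n x)
      have h2 := hd.triangle x (f y) (g n x)
      have h3 := hd.nonneg x (f x)
      have h4 := hd.nonneg x (f y)
      rcases hclose n with h | h
      · linarith [h.1, hn1 n]
      · linarith [h.2, hn1 n])
  obtain ⟨k, hk, rfl⟩ := exists_mem_of_tendsto hd hG hcl hg (hd.continuous_of_isometry hF.2) hlim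
  have hzero : Tendsto (fun n : ℕ => 1 / ((n : ℝ) + 1)) (hyperfilter ℕ) (𝓝 0) :=
    tendsto_one_div_add_atTop_nhds_zero_nat.mono_left Nat.hyperfilter_le_atTop
  have key : ∀ z w, (∀ᶠ n in (hyperfilter ℕ : Filter ℕ), d z (g n w) < 1 / ((n : ℝ) + 1)) →
      z = k w := fun z w hzw => by
    refine hd.eq_of_eq_zero _ _ (le_antisymm ?_ (hd.nonneg _ _))
    exact le_of_tendsto_of_tendsto (((hd.continuous_right z).tendsto (k w)).comp (hlim w)) hzero
      (hzw.mono fun n hn => hn.le)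
  refine ⟨k, hk, ?_⟩
  rcases Ultrafilter.eventually_or.1 (Eventually.of_forall (f := (hyperfilter ℕ : Filter ℕ)) hclose)
    with h | h
  · exact Or.inl ⟨key _ _ (h.mono fun _ h => h.1), key _ _ (h.mono fun _ h => h.2)⟩
  · exact Or.inr ⟨key _ _ (h.mono fun _ h => h.1), key _ _ (h.mono fun _ h => h.2)⟩

theorem exists_mem_apply_eq_of_pairs {G : Subgroup (X ≃ₜ X)}
    (hGX : ¬ (Nat.card G = 1 ∧ Nat.card X = 2)) {f : X → X} (hf : Function.Injective f)
    [Nontrivial X]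
    (h : ∀ x y, x ≠ y → ∃ g ∈ G, (f x = g x ∧ f y = g y) ∨ (f x = g y ∧ f y = g x)) (x : X) :
    ∃ g ∈ G, f x = g x := by
  by_contra! hx
  have h1 : ∀ y, y ≠ x → ∃ g ∈ G, f x = g y ∧ f y = g x := fun y hy => by
    obtain ⟨g, hg, h | h⟩ := h x y hy.symm
    · exact absurd h.1 (hx g hg)
    · exact ⟨g, hg, h⟩
  have hfix : ∀ g ∈ G, g x = x := fun g hg => by
    by_contra hgx
    obtain ⟨k, hk, e, -⟩ := h1 (g x) hgx
    exact hx (k * g) (G.mul_mem hk hg) e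
  have hfx : ∀ y, y ≠ x → f y = x := fun y hy => by
    obtain ⟨g, hg, -, e⟩ := h1 y hy
    rw [e, hfix g hg]
  obtain ⟨y, hy⟩ := exists_ne x
  have huniq : ∀ z, z = x ∨ z = y := fun z => by
    by_contra! hz
    exact hz.2 (hf ((hfx z hz.1).trans (hfx y hy).symm))
  refine hGX ⟨?_, ?_⟩
  · rw [Nat.card_eq_one_iff_unique]
    refine ⟨⟨fun g k => Subtype.ext (Homeomorph.ext fun z => ?_)⟩, ⟨1⟩⟩
    rcases huniq z with rfl | rfl
    · rw [hfix g g.2, hfix k k.2]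
    · have : ∀ g ∈ G, g z = z := fun g hg => (huniq (g z)).resolve_left fun e =>
        hy (g.injective (e.trans (hfix g hg).symm))
      rw [this g g.2, this k k.2]
  · rw [Nat.card_eq_two_iff]
    exact ⟨x, y, hy.symm, by ext z; simpa using huniq z⟩

/-- Every invariant proper metric can be slightly increased so that its isometry group becomes
the given one. -/
theorem exists_metric_isometries_eq [SecondCountableTopology X] {d : X → X → ℝ}
    (hd : IsProperMetric d) (G : Subgroup (X ≃ₜ X)) (hGX : ¬ (Nat.card G = 1 ∧ Nat.card X = 2))
    (hG : ∀ g ∈ G, ∀ x y, d (g x) (g y) = d x y)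
    (hcl : IsClosed (underlyingContinuousMaps (G : Set (X ≃ₜ X))))
    (hhull : symmetrizedTwoHull (underlyingMaps (G : Set (X ≃ₜ X))) =
      underlyingMaps (G : Set (X ≃ₜ X))) {ε : ℝ} (hε : 0 < ε) :
    ∃ ρ : X → X → ℝ, IsProperMetric ρ ∧ (∀ x y, d x y ≤ ρ x y ∧ ρ x y ≤ (1 + ε) * d x y) ∧
      ∀ f, IsBijIsometry ρ f ↔ f ∈ underlyingMaps (G : Set (X ≃ₜ X)) := by
  rcases subsingleton_or_nontrivial X with hX | hX
  · refine ⟨d, hd, fun x y => ⟨le_rfl, ?_⟩, fun f => ⟨fun _ => ⟨1, G.one_mem, ?_⟩, ?_⟩⟩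
    · linarith [mul_nonneg hε.le (hd.nonneg x y)]
    · exact Subsingleton.elim _ _
    · rintro ⟨g, hg, rfl⟩
      exact ⟨g.bijective, hG g hg⟩
  obtain ⟨x₀, y₀, hxy₀⟩ := exists_pair_ne X
  have : Nonempty {p : X × X | p.1 ≠ p.2} := ⟨⟨(x₀, y₀), hxy₀⟩⟩
  obtain ⟨u, hu⟩ := TopologicalSpace.exists_dense_seq {p : X × X | p.1 ≠ p.2}
  obtain ⟨ρ, hρ, hρG, hle, hge, hpair⟩ := exists_metric_isometry_pairs hd G hG x₀
    (fun i => (u i).1) (fun i => (u i).2) hε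
  refine ⟨ρ, hρ, fun x y => ⟨hle x y, hge x y⟩, fun f => ⟨fun hf => ?_, ?_⟩⟩
  swap
  · rintro ⟨g, hg, rfl⟩
    exact ⟨g.bijective, hρG g hg⟩
  have hfc : Continuous f := hρ.continuous_of_isometry hf.2
  have hne : ∀ x y, x ≠ y → ∃ g ∈ G, (f x = g x ∧ f y = g y) ∨ (f x = g y ∧ f y = g x) := by
    intro x y hxy
    refine exists_mem_pair_of_pairClose hd hG hcl fun r hr => ?_
    have hr3 : 0 < r / 3 := by positivity
    have e1 : Continuous fun p : {p : X × X | p.1 ≠ p.2} => d x p.1.1 :=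
      (hd.continuous_right x).comp (continuous_fst.comp continuous_subtype_val)
    have e2 : Continuous fun p : {p : X × X | p.1 ≠ p.2} => d y p.1.2 :=
      (hd.continuous_right y).comp (continuous_snd.comp continuous_subtype_val)
    have e3 : Continuous fun p : {p : X × X | p.1 ≠ p.2} => d (f x) (f p.1.1) :=
      (hd.continuous_right _).comp (hfc.comp (continuous_fst.comp continuous_subtype_val))
    have e4 : Continuous fun p : {p : X × X | p.1 ≠ p.2} => d (f y) (f p.1.2) :=
      (hd.continuous_right _).comp (hfc.comp (continuous_snd.comp continuous_subtype_val))
    have hev : ∀ᶠ p in 𝓝 (⟨(x, y), hxy⟩ : {p : X × X | p.1 ≠ p.2}), d x p.1.1 < r / 3 ∧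
        d y p.1.2 < r / 3 ∧ d (f x) (f p.1.1) < r / 3 ∧ d (f y) (f p.1.2) < r / 3 := by
      refine (e1.continuousAt.eventually_lt_const ?_).and
        ((e2.continuousAt.eventually_lt_const ?_).and
        ((e3.continuousAt.eventually_lt_const ?_).and (e4.continuousAt.eventually_lt_const ?_))) <;>
      simpa only [hd.self] using hr3
    obtain ⟨_, ⟨i, rfl⟩, h1, h2, h3, h4⟩ := hu.inter_nhds_nonempty hev
    have key : ∀ z w a b, ∀ g ∈ G, d (f z) (f a) < r / 3 → d (f a) (g b) < r / 3 →
        d w b < r / 3 → d (f z) (g w) < r := fun z w a b g hg k1 k2 k3 => by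
      have t1 := hd.triangle (f z) (f a) (g w)
      have t2 := hd.triangle (f a) (g b) (g w)
      rw [hG g hg, hd.comm b w] at t2
      linarith
    obtain ⟨g, hg, h | h⟩ := hpair f hf i (r / 3) hr3
    · exact ⟨g, hg, Or.inl ⟨key _ _ _ _ g hg h3 h.1 h1, key _ _ _ _ g hg h4 h.2 h2⟩⟩
    · exact ⟨g, hg, Or.inr ⟨key _ _ _ _ g hg h3 h.1 h2, key _ _ _ _ g hg h4 h.2 h1⟩⟩
  rw [← hhull]
  intro x y
  rcases eq_or_ne x y with rfl | hxy
  · obtain ⟨g, hg, e⟩ := exists_mem_apply_eq_of_pairs hGX hf.1.1 hne x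
    exact ⟨g, ⟨g, hg, rfl⟩, by rw [e]⟩
  · obtain ⟨g, hg, e⟩ := hne x y hxy
    exact ⟨g, ⟨g, hg, rfl⟩, pair_eq_pair_iff.2 e⟩

end Approximation

section Chain

variable {X : Type*}

/-- An increasing sequence of relations, each containing the threefold composition of the
previous one. -/
def coarseRel (q : X → X → ℝ) (E : ℕ → X → X → Prop) : ℕ → X → X → Prop
  | 0 => fun x y => q x y < 1
  | k + 1 => fun x y =>
    (∃ u v, coarseRel q E k x u ∧ coarseRel q E k u v ∧ coarseRel q E k v y) ∨ E k x y

variable {q : X → X → ℝ} {E : ℕ → X → X → Prop}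

theorem coarseRel_refl (hq : ∀ x, q x x = 0) : ∀ k x, coarseRel q E k x x
  | 0, x => by simp [coarseRel, hq]
  | k + 1, x => Or.inl ⟨x, x, coarseRel_refl hq k x, coarseRel_refl hq k x, coarseRel_refl hq k x⟩

theorem coarseRel_mono (hq : ∀ x, q x x = 0) {k l : ℕ} (hkl : k ≤ l) {x y : X}
    (h : coarseRel q E k x y) : coarseRel q E l x y := by
  induction l, hkl using Nat.le_induction with
  | base => exact h
  | succ l _ ih => exact Or.inl ⟨x, x, coarseRel_refl hq l x, coarseRel_refl hq l x, ih⟩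

theorem coarseRel_symm (hq : ∀ x y, q x y = q y x) (hE : ∀ k x y, E k x y → E k y x) :
    ∀ k x y, coarseRel q E k x y → coarseRel q E k y x
  | 0, x, y => fun h => (hq y x).trans_lt h
  | k + 1, x, y => by
    rintro (⟨u, v, h1, h2, h3⟩ | h)
    · exact Or.inl ⟨v, u, coarseRel_symm hq hE k _ _ h3, coarseRel_symm hq hE k _ _ h2,
        coarseRel_symm hq hE k _ _ h1⟩
    · exact Or.inr (hE k x y h)

theorem coarseRel_map {g : X → X} (hq : ∀ x y, q (g x) (g y) = q x y)
    (hE : ∀ k x y, E k x y → E k (g x) (g y)) :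
    ∀ k x y, coarseRel q E k x y → coarseRel q E k (g x) (g y)
  | 0, x, y => fun h => (hq x y).trans_lt h
  | k + 1, x, y => by
    rintro (⟨u, v, h1, h2, h3⟩ | h)
    · exact Or.inl ⟨g u, g v, coarseRel_map hq hE k _ _ h1, coarseRel_map hq hE k _ _ h2,
        coarseRel_map hq hE k _ _ h3⟩
    · exact Or.inr (hE k x y h)

theorem coarseRel_compact [TopologicalSpace X]
    (hq : ∀ K : Set X, IsCompact K → ∃ C, IsCompact C ∧ ∀ x ∈ K, ∀ y, q x y < 1 → y ∈ C)
    (hE : ∀ k, ∀ K : Set X, IsCompact K → ∃ C, IsCompact C ∧ ∀ x ∈ K, ∀ y, E k x y → y ∈ C) :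
    ∀ k, ∀ K : Set X, IsCompact K →
      ∃ C, IsCompact C ∧ ∀ x ∈ K, ∀ y, coarseRel q E k x y → y ∈ C
  | 0 => hq
  | k + 1 => fun K hK => by
    obtain ⟨C₁, hC₁, h1⟩ := coarseRel_compact hq hE k K hK
    obtain ⟨C₂, hC₂, h2⟩ := coarseRel_compact hq hE k C₁ hC₁
    obtain ⟨C₃, hC₃, h3⟩ := coarseRel_compact hq hE k C₂ hC₂
    obtain ⟨C, hC, h⟩ := hE k K hK
    refine ⟨C₃ ∪ C, hC₃.union hC, fun x hx y => ?_⟩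
    rintro (⟨u, v, k1, k2, k3⟩ | hxy)
    · exact Or.inl (h3 v (h2 u (h1 x hx u k1) v k2) y k3)
    · exact Or.inr (h x hx y hxy)

theorem exists_coarseRel (hE : ∀ x y, ∃ k, E k x y) (x y : X) : ∃ k, coarseRel q E k x y :=
  let ⟨k, hk⟩ := hE x y
  ⟨k + 1, Or.inr hk⟩

open Classical in
/-- The cube root of `q` at small scale, and the exponential of the rank with respect to
`coarseRel` at large scale. -/
noncomputable def preDist (hE : ∀ x y, ∃ k, E k x y) (q : X → X → ℝ) (x y : X) : ℝ :=
  if q x y < 1 then q x y ^ (1 / 3 : ℝ) else 2 ^ Nat.find (exists_coarseRel (q := q) hE x y) / 2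

variable (hE : ∀ x y, ∃ k, E k x y)

theorem preDist_of_lt {x y : X} (h : q x y < 1) : preDist hE q x y = q x y ^ (1 / 3 : ℝ) :=
  if_pos h

theorem preDist_nonneg (hq : ∀ x y, 0 ≤ q x y) (x y : X) : 0 ≤ preDist hE q x y := by
  unfold preDist
  split_ifs
  · exact Real.rpow_nonneg (hq x y) _
  · positivity

theorem preDist_pow (hq : ∀ x y, 0 ≤ q x y) {x y : X} (h : q x y < 1) :
    preDist hE q x y ^ 3 = q x y := by
  rw [preDist_of_lt hE h, ← Real.rpow_natCast, ← Real.rpow_mul (hq x y)]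
  norm_num

theorem preDist_lt_one (hq : ∀ x y, 0 ≤ q x y) {x y : X} (h : q x y < 1) :
    preDist hE q x y < 1 := by
  refine lt_of_pow_lt_pow_left₀ 3 zero_le_one ?_
  rwa [preDist_pow hE hq h, one_pow]

theorem preDist_le_of_coarseRel (hq : ∀ x y, 0 ≤ q x y) {x y : X} {n : ℕ}
    (h : coarseRel q E (n + 1) x y) : preDist hE q x y ≤ 2 ^ n := by
  classical
  by_cases hlt : q x y < 1
  · exact (preDist_lt_one hE hq hlt).le.trans (one_le_pow₀ one_le_two)
  · unfold preDist
    rw [if_neg hlt, div_le_iff₀ two_pos, ← pow_succ]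
    exact pow_le_pow_right₀ one_le_two (Nat.find_min' _ h)

theorem coarseRel_of_preDist_lt (hq : ∀ x, q x x = 0) {x y : X} {n : ℕ}
    (h : preDist hE q x y < 2 ^ n) : coarseRel q E n x y := by
  classical
  by_cases hlt : q x y < 1
  · exact coarseRel_mono hq (Nat.zero_le n) (show coarseRel q E 0 x y from hlt)
  · unfold preDist at h
    rw [if_neg hlt, div_lt_iff₀ two_pos, ← pow_succ, pow_lt_pow_iff_right₀ one_lt_two] at h
    exact coarseRel_mono hq (Nat.lt_succ_iff.1 h) (Nat.find_spec (exists_coarseRel hE x y))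

theorem preDist_congr {x y x' y' : X} (h : q x y = q x' y')
    (hR : ∀ k, coarseRel q E k x y ↔ coarseRel q E k x' y') :
    preDist hE q x y = preDist hE q x' y' := by
  classical
  unfold preDist
  simp only [h, hR]

theorem preDist_le_two_mul (hq0 : ∀ x y, 0 ≤ q x y) (hq : ∀ x, q x x = 0)
    (hquasi : ∀ x₁ x₂ x₃ x₄ M, q x₁ x₂ < 1 → q x₂ x₃ < 1 → q x₃ x₄ < 1 → q x₁ x₂ ≤ M →
      q x₂ x₃ ≤ M → q x₃ x₄ ≤ M → q x₁ x₄ ≤ 8 * M) {x₁ x₂ x₃ x₄ : X} {m : ℝ}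
    (h1 : preDist hE q x₁ x₂ ≤ m) (h2 : preDist hE q x₂ x₃ ≤ m) (h3 : preDist hE q x₃ x₄ ≤ m) :
    preDist hE q x₁ x₄ ≤ 2 * m := by
  have hm0 : 0 ≤ m := (preDist_nonneg hE hq0 _ _).trans h1
  rcases lt_or_ge m 1 with hm | hm
  · have hR : ∀ {x y}, preDist hE q x y ≤ m → q x y < 1 := fun h =>
      coarseRel_of_preDist_lt hE hq (n := 0) (by simpa using h.trans_lt hm)
    have hM : ∀ {x y}, preDist hE q x y ≤ m → q x y ≤ m ^ 3 := fun {x y} h => by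
      rw [← preDist_pow hE hq0 (hR h)]
      exact pow_le_pow_left₀ (preDist_nonneg hE hq0 x y) h 3
    have h4 := hquasi x₁ x₂ x₃ x₄ (m ^ 3) (hR h1) (hR h2) (hR h3) (hM h1) (hM h2) (hM h3)
    have h5 : q x₁ x₄ ≤ (2 * m) ^ 3 := h4.trans_eq (by ring)
    rcases lt_or_ge (q x₁ x₄) 1 with hlt | hge
    · refine le_of_pow_le_pow_left₀ three_ne_zero (by positivity) ?_
      rwa [preDist_pow hE hq0 hlt]
    · have h6 : preDist hE q x₁ x₄ ≤ 2 ^ 0 := preDist_le_of_coarseRel hE hq0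
        (Or.inl ⟨x₂, x₃, hR h1, hR h2, hR h3⟩)
      refine h6.trans (le_of_pow_le_pow_left₀ three_ne_zero (by positivity) ?_)
      simpa using hge.trans h5
  · obtain ⟨n, hn1, hn2⟩ := exists_nat_pow_near hm one_lt_two
    have hR : ∀ {x y}, preDist hE q x y ≤ m → coarseRel q E (n + 1) x y := fun h =>
      coarseRel_of_preDist_lt hE hq (h.trans_lt hn2)
    have h4 : preDist hE q x₁ x₄ ≤ 2 ^ (n + 1) := preDist_le_of_coarseRel hE hq0
      (Or.inl ⟨x₂, x₃, hR h1, hR h2, hR h3⟩)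
    rw [pow_succ] at h4
    linarith

theorem dist_ofPreNNDist_map_le {p : X → X → NNReal} (h0 : ∀ x, p x x = 0)
    (hs : ∀ x y, p x y = p y x) {g : X → X} (hg : ∀ x y, p (g x) (g y) = p x y) (x y : X) :
    (PseudoMetricSpace.ofPreNNDist p h0 hs).dist (g x) (g y) ≤
      (PseudoMetricSpace.ofPreNNDist p h0 hs).dist x y := by
  refine NNReal.coe_le_coe.2 (le_ciInf fun l => ?_)
  refine (ciInf_le (OrderBot.bddBelow _) (l.map g)).trans_eq ?_
  have : (g x :: l.map g) = (x :: l).map g := rfl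
  have h2 : l.map g ++ [g y] = (l ++ [y]).map g := by simp
  rw [this, h2, List.zipWith_map]
  simp only [hg]

/-- A proper metric from a quasi-metric at small scale and an exhausting sequence of relations
at large scale. -/
theorem exists_properMetric_of_coarse [TopologicalSpace X] (G : Subgroup (X ≃ₜ X))
    (hE : ∀ x y, ∃ k, E k x y) (hq0 : ∀ x y, 0 ≤ q x y) (hq : ∀ x, q x x = 0) (hqs : ∀ x y, q x y = q y x)
    (hqe : ∀ x y, q x y = 0 → x = y) (hqt : ∀ x, Tendsto (fun y => q x y) (𝓝 x) (𝓝 0))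
    (hquasi : ∀ x₁ x₂ x₃ x₄ M, q x₁ x₂ < 1 → q x₂ x₃ < 1 → q x₃ x₄ < 1 → q x₁ x₂ ≤ M →
      q x₂ x₃ ≤ M → q x₃ x₄ ≤ M → q x₁ x₄ ≤ 8 * M)
    (hqc : ∀ K : Set X, IsCompact K → ∃ C, IsCompact C ∧ ∀ x ∈ K, ∀ y, q x y < 1 → y ∈ C)
    (hqG : ∀ g ∈ G, ∀ x y, q (g x) (g y) = q x y)
    (hEs : ∀ k x y, E k x y → E k y x)
    (hEc : ∀ k, ∀ K : Set X, IsCompact K → ∃ C, IsCompact C ∧ ∀ x ∈ K, ∀ y, E k x y → y ∈ C)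
    (hEG : ∀ g ∈ G, ∀ k x y, E k x y → E k (g x) (g y)) :
    ∃ ρ : X → X → ℝ, IsProperMetric ρ ∧ ∀ g ∈ G, ∀ x y, ρ (g x) (g y) = ρ x y := by
  have hp0 := preDist_nonneg hE hq0
  have hps : ∀ x y, preDist hE q x y = preDist hE q y x := fun x y =>
    preDist_congr hE (hqs x y) fun k => ⟨coarseRel_symm hqs hEs k x y, coarseRel_symm hqs hEs k y x⟩
  have hpG : ∀ g ∈ G, ∀ x y, preDist hE q (g x) (g y) = preDist hE q x y := fun g hg x y => by
    refine preDist_congr hE (hqG g hg x y) fun k =>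
      ⟨fun h => ?_, coarseRel_map (hqG g hg) (hEG g hg) k x y⟩
    have := coarseRel_map (hqG _ (G.inv_mem hg)) (hEG _ (G.inv_mem hg)) k _ _ h
    simpa using this
  set p : X → X → NNReal := fun x y => ⟨preDist hE q x y, hp0 x y⟩
  have p0 : ∀ x, p x x = 0 := fun x => NNReal.eq (by
    change preDist hE q x x = 0
    rw [preDist_of_lt hE (by simp [hq]), hq]
    norm_num)
  have ps : ∀ x y, p x y = p y x := fun x y => NNReal.eq (hps x y)
  set m := PseudoMetricSpace.ofPreNNDist p p0 ps
  have hle : ∀ x y, m.dist x y ≤ preDist hE q x y :=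
    PseudoMetricSpace.dist_ofPreNNDist_le p p0 ps
  have hge : ∀ x y, preDist hE q x y ≤ 2 * m.dist x y :=
    PseudoMetricSpace.le_two_mul_dist_ofPreNNDist p p0 ps fun x₁ x₂ x₃ x₄ => by
      rw [← NNReal.coe_le_coe]
      push_cast
      exact preDist_le_two_mul hE hq0 hq hquasi (le_max_left _ _)
        ((le_max_left _ _).trans (le_max_right _ _)) ((le_max_right _ _).trans (le_max_right _ _))
  have hpt : ∀ x, Tendsto (fun y => preDist hE q x y) (𝓝 x) (𝓝 0) := fun x => by
    have h1 : Tendsto (fun y => q x y ^ (1 / 3 : ℝ)) (𝓝 x) (𝓝 (0 ^ (1 / 3 : ℝ))) :=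
      (hqt x).rpow_const (Or.inr (by norm_num))
    rw [Real.zero_rpow (by norm_num)] at h1
    refine h1.congr' ?_
    filter_upwards [(hqt x).eventually_lt_const one_pos] with y hy
    exact (preDist_of_lt hE hy).symm
  have hnn : ∀ x y, 0 ≤ m.dist x y := fun x y => dist_nonneg
  have hcont : Continuous fun z : X × X => m.dist z.1 z.2 :=
    continuous_of_tendsto_zero m.dist_comm m.dist_triangle fun x =>
      squeeze_zero (fun y => hnn x y) (fun y => hle x y) (hpt x)
  refine ⟨m.dist, ⟨m.dist_self, m.dist_comm, m.dist_triangle, fun x y h => ?_, hcont,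
    fun x r => ?_⟩, fun g hg x y => ?_⟩
  · have h1 := hge x y
    rw [h, mul_zero] at h1
    have h2 : preDist hE q x y = 0 := le_antisymm h1 (hp0 x y)
    have h3 : q x y < 1 := coarseRel_of_preDist_lt hE hq (n := 0) (by simp [h2])
    refine hqe x y ?_
    rw [← preDist_pow hE hq0 h3, h2]
    norm_num
  · obtain ⟨n, hn⟩ := pow_unbounded_of_one_lt (2 * r) one_lt_two
    obtain ⟨C, hC, h⟩ := coarseRel_compact hqc hEc n {x} isCompact_singleton
    refine hC.of_isClosed_subset
      (isClosed_le (hcont.comp (Continuous.prodMk_right x)) continuous_const) fun y hy => ?_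
    refine h x rfl y (coarseRel_of_preDist_lt hE hq ?_)
    have hy' : m.dist x y ≤ r := hy
    linarith [hge x y]
  · refine le_antisymm (dist_ofPreNNDist_map_le p0 ps (fun x y => NNReal.eq (hpG g hg x y)) x y) ?_
    have := dist_ofPreNNDist_map_le p0 ps
      (fun x y => NNReal.eq (hpG _ (G.inv_mem hg) x y)) (g x) (g y)
    simpa using this

end Chain

section Equicontinuity

theorem exists_finite_of_isEvenlyContinuous {X Y : Type*} [TopologicalSpace X]
    [TopologicalSpace Y] {F : Set (X → Y)} (hF : IsEvenlyContinuous F)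
    (hF' : IsPointwisePrecompact F) (x : X) {W : Y → Set Y} (hW : ∀ y, W y ∈ 𝓝 y) :
    ∃ t : Finset Y, ∃ U ∈ 𝓝 x, ∀ f ∈ F, ∃ y ∈ t, f x ∈ W y ∧ ∀ z ∈ U, f z ∈ W y := by
  choose U hU V hV h using fun y => hF x y (W y) (hW y)
  obtain ⟨t, -, ht⟩ := (hF' x).elim_nhds_subcover (fun y => V y ∩ W y)
    fun y _ => inter_mem (hV y) (hW y)
  refine ⟨t, ⋂ y ∈ t, U y, (biInter_finset_mem t).2 fun y _ => hU y, fun f hf => ?_⟩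
  obtain ⟨y, hy, hfx⟩ := mem_iUnion₂.1 (ht (subset_closure ⟨f, hf, rfl⟩))
  exact ⟨y, hy, hfx.2, fun z hz => h y f hf hfx.1 (mem_image_of_mem f (mem_iInter₂.1 hz y hy))⟩

variable {X : Type*} [TopologicalSpace X] {G : Subgroup (X ≃ₜ X)}

theorem exists_compact_of_returnSet [LocallyCompactSpace X]
    (hG : ∀ K : Set X, IsCompact K → IsEvenlyContinuous (underlyingMaps (returnSet G K)) ∧
      IsPointwisePrecompact (underlyingMaps (returnSet G K))) {K : Set X} (hK : IsCompact K) :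
    ∃ C, IsCompact C ∧ ∀ x ∈ K, ∀ g ∈ returnSet G K, g x ∈ C := by
  refine hK.induction_on (p := fun S => ∃ C, IsCompact C ∧ ∀ x ∈ S, ∀ g ∈ returnSet G K, g x ∈ C)
    ⟨∅, isCompact_empty, by simp⟩ ?_ ?_ ?_
  · rintro s t hst ⟨C, hC, h⟩
    exact ⟨C, hC, fun x hx => h x (hst hx)⟩
  · rintro s t ⟨C, hC, h⟩ ⟨C', hC', h'⟩
    exact ⟨C ∪ C', hC.union hC', fun x hx g hg =>
      hx.elim (fun hx => Or.inl (h x hx g hg)) fun hx => Or.inr (h' x hx g hg)⟩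
  · intro x hx
    choose W hW hWx using fun y : X => exists_compact_mem_nhds y
    obtain ⟨t, U, hU, h⟩ := exists_finite_of_isEvenlyContinuous (hG K hK).1 (hG K hK).2 x hWx
    refine ⟨U, mem_nhdsWithin_of_mem_nhds hU, ⋃ y ∈ t, W y,
      t.isCompact_biUnion fun y _ => hW y, fun z hz g hg => ?_⟩
    obtain ⟨y, hy, -, h2⟩ := h g ⟨g, hg, rfl⟩
    exact mem_iUnion₂.2 ⟨y, hy, h2 z hz⟩

theorem eventually_abs_sub_lt_of_compactSupport [LocallyCompactSpace X]
    (hG : ∀ K : Set X, IsCompact K → IsEvenlyContinuous (underlyingMaps (returnSet G K)) ∧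
      IsPointwisePrecompact (underlyingMaps (returnSet G K))) {ψ : X → ℝ} (hψ : Continuous ψ)
    {S : Set X} (hS : IsCompact S) (hψS : ∀ x, x ∉ S → ψ x = 0) (x : X) {ε : ℝ} (hε : 0 < ε) :
    ∀ᶠ y in 𝓝 x, ∀ g ∈ G, |ψ (g x) - ψ (g y)| < ε := by
  obtain ⟨N, hN, hxN⟩ := exists_compact_mem_nhds x
  have hK := hN.union hS
  obtain ⟨t, U, hU, h⟩ := exists_finite_of_isEvenlyContinuous (hG _ hK).1 (hG _ hK).2 x
    (W := fun y => {z | |ψ z - ψ y| < ε / 2}) fun y => by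
      have : Continuous fun z => |ψ z - ψ y| := by fun_prop
      refine this.continuousAt.eventually_lt_const ?_
      simpa using half_pos hε
  filter_upwards [hU, hxN] with y hyU hyN g hg
  by_cases hgS : g x ∈ S ∨ g y ∈ S
  · have hmem : g ∈ returnSet G (N ∪ S) := by
      refine ⟨hg, ?_⟩
      rcases hgS with hs | hs
      · exact ⟨g x, mem_image_of_mem g (Or.inl (mem_of_mem_nhds hxN)), Or.inr hs⟩
      · exact ⟨g y, mem_image_of_mem g (Or.inl hyN), Or.inr hs⟩
    obtain ⟨w, -, h1, h2⟩ := h g ⟨g, hmem, rfl⟩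
    have h1 : |ψ (g x) - ψ w| < ε / 2 := h1
    have h2 : |ψ (g y) - ψ w| < ε / 2 := h2 y hyU
    rw [abs_lt] at *
    constructor <;> linarith
  · push Not at hgS
    rw [hψS _ hgS.1, hψS _ hgS.2]
    simpa using hε

end Equicontinuity

theorem exists_bump_sequence (X : Type*) [TopologicalSpace X] [PolishSpace X]
    [LocallyCompactSpace X] :
    ∃ φ : ℕ → X → ℝ, (∀ n, Continuous (φ n)) ∧
      (∀ n, ∃ S, IsCompact S ∧ ∀ x, x ∉ S → φ n x = 0) ∧
      (∀ n x, 0 ≤ φ n x) ∧ (∀ (n : ℕ) x, φ n x ≤ 1 / ((n : ℝ) + 1)) ∧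
      ∀ x, ∀ U ∈ 𝓝 x, ∃ n, 0 < φ n x ∧ ∀ y, y ∉ U → φ n y = 0 := by
  classical
  rcases isEmpty_or_nonempty X with hX | hX
  · exact ⟨fun _ _ => 0, fun _ => continuous_const, fun _ => ⟨∅, isCompact_empty, fun _ _ => rfl⟩,
      fun _ _ => le_rfl, fun _ _ => by positivity, fun x => hX.elim x⟩
  let _ := TopologicalSpace.metrizableSpaceMetric X
  let c : ℕ → X := fun n => TopologicalSpace.denseSeq X n.unpair.1
  let s : ℕ → ℝ := fun n => 1 / ((n.unpair.2 : ℝ) + 1)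
  have hs1 : ∀ n, s n ≤ 1 := fun n => by
    rw [div_le_one (by positivity)]
    linarith [(Nat.cast_nonneg n.unpair.2 : (0 : ℝ) ≤ _)]
  let φ : ℕ → X → ℝ := fun n x => if IsCompact (Metric.closedBall (c n) (s n)) then
    1 / ((n : ℝ) + 1) * max 0 (s n - dist x (c n)) else 0
  have hφ : ∀ n, IsCompact (Metric.closedBall (c n) (s n)) →
      φ n = fun x => 1 / ((n : ℝ) + 1) * max 0 (s n - dist x (c n)) := fun n hn => by
    simp [φ, hn]
  have hφ' : ∀ n, ¬ IsCompact (Metric.closedBall (c n) (s n)) → φ n = fun x => 0 := fun n hn => by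
    simp [φ, hn]
  have hn0 : ∀ n : ℕ, 0 < 1 / ((n : ℝ) + 1) := fun n => by positivity
  have hout : ∀ n x, s n ≤ dist x (c n) → φ n x = 0 := fun n x hx => by
    by_cases hc : IsCompact (Metric.closedBall (c n) (s n))
    · simp only [hφ n hc]
      rw [max_eq_left (by linarith), mul_zero]
    · rw [hφ' n hc]
  refine ⟨φ, fun n => ?_, fun n => ?_, fun n x => ?_, fun n x => ?_, fun x U hU => ?_⟩
  · by_cases hc : IsCompact (Metric.closedBall (c n) (s n))
    · rw [hφ n hc]
      fun_prop
    · rw [hφ' n hc]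
      exact continuous_const
  · by_cases hc : IsCompact (Metric.closedBall (c n) (s n))
    · exact ⟨_, hc, fun x hx => hout n x (not_le.1 hx).le⟩
    · exact ⟨∅, isCompact_empty, fun x _ => by rw [hφ' n hc]⟩
  · by_cases hc : IsCompact (Metric.closedBall (c n) (s n))
    · rw [hφ n hc]
      exact mul_nonneg (hn0 n).le (le_max_left _ _)
    · rw [hφ' n hc]
  · by_cases hc : IsCompact (Metric.closedBall (c n) (s n))
    · rw [hφ n hc]
      refine mul_le_of_le_one_right (hn0 n).le (max_le zero_le_one ?_)
      linarith [hs1 n, dist_nonneg (x := x) (y := c n)]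
    · rw [hφ' n hc]
      exact (hn0 n).le
  · obtain ⟨r, hr, hcr⟩ := Metric.exists_isCompact_closedBall x
    obtain ⟨ε, hε, hεU⟩ := Metric.mem_nhds_iff.1 hU
    obtain ⟨k, hk⟩ := exists_nat_one_div_lt (half_pos (lt_min hr hε))
    have hk0 : 0 < 1 / ((k : ℝ) + 1) := by positivity
    obtain ⟨m, hm⟩ := (TopologicalSpace.denseRange_denseSeq X).exists_dist_lt x hk0
    have hcn : c (Nat.pair m k) = TopologicalSpace.denseSeq X m := by simp [c]
    have hsn : s (Nat.pair m k) = 1 / ((k : ℝ) + 1) := by simp [s]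
    have hkr := hk.trans_le ((div_le_div_iff_of_pos_right two_pos).2 (min_le_left r ε))
    have hkε := hk.trans_le ((div_le_div_iff_of_pos_right two_pos).2 (min_le_right r ε))
    have hc : IsCompact (Metric.closedBall (c (Nat.pair m k)) (s (Nat.pair m k))) := by
      refine hcr.of_isClosed_subset Metric.isClosed_closedBall
        (Metric.closedBall_subset_closedBall' ?_)
      rw [hcn, hsn, dist_comm]
      linarith
    refine ⟨Nat.pair m k, ?_, fun y hy => hout _ _ ?_⟩
    · rw [hφ _ hc]
      refine mul_pos (hn0 _) (lt_max_of_lt_right ?_)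
      rw [hcn, hsn]
      linarith
    · rw [hcn, hsn]
      by_contra! hlt
      refine hy (hεU (Metric.mem_ball.2 ?_))
      have := dist_triangle y (TopologicalSpace.denseSeq X m) x
      rw [dist_comm (TopologicalSpace.denseSeq X m) x] at this
      linarith

section Family

variable {X ι : Type*} {Φ : ι → X → ℝ}

/-- The pseudometric defined by a family of functions. -/
noncomputable def familyDist (Φ : ι → X → ℝ) (x y : X) : ℝ := ⨆ i, |Φ i x - Φ i y|

/-- The supremum of a family of functions. -/
noncomputable def familySup (Φ : ι → X → ℝ) (x : X) : ℝ := ⨆ i, Φ i x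

/-- The quasi-metric `8 * familyDist` rescaled by `familySup`. -/
noncomputable def familyQuasi (Φ : ι → X → ℝ) (x y : X) : ℝ :=
  8 * familyDist Φ x y / min (familySup Φ x) (familySup Φ y)

theorem familyDist_nonneg (x y : X) : 0 ≤ familyDist Φ x y :=
  Real.iSup_nonneg fun _ => abs_nonneg _

theorem familyDist_comm (x y : X) : familyDist Φ x y = familyDist Φ y x :=
  iSup_congr fun _ => abs_sub_comm _ _

theorem familyDist_self (x : X) : familyDist Φ x x = 0 := by simp [familyDist]

theorem abs_sub_le_familyDist (h0 : ∀ i x, 0 ≤ Φ i x) (h1 : ∀ i x, Φ i x ≤ 1) (i : ι) (x y : X) :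
    |Φ i x - Φ i y| ≤ familyDist Φ x y := by
  refine le_ciSup (f := fun i => |Φ i x - Φ i y|) ⟨1, ?_⟩ i
  rintro _ ⟨i, rfl⟩
  simp only [abs_le]
  constructor <;> linarith [h0 i x, h0 i y, h1 i x, h1 i y]

theorem familyDist_triangle (h0 : ∀ i x, 0 ≤ Φ i x) (h1 : ∀ i x, Φ i x ≤ 1) (x y z : X) :
    familyDist Φ x z ≤ familyDist Φ x y + familyDist Φ y z := by
  refine Real.iSup_le (fun i => ?_) (add_nonneg (familyDist_nonneg _ _) (familyDist_nonneg _ _))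
  exact (abs_sub_le _ (Φ i y) _).trans
    (add_le_add (abs_sub_le_familyDist h0 h1 i x y) (abs_sub_le_familyDist h0 h1 i y z))

theorem le_familySup (h1 : ∀ i x, Φ i x ≤ 1) (i : ι) (x : X) : Φ i x ≤ familySup Φ x :=
  le_ciSup (f := fun i => Φ i x) ⟨1, by rintro _ ⟨i, rfl⟩; exact h1 i x⟩ i

theorem familySup_le_add (h0 : ∀ i x, 0 ≤ Φ i x) (h1 : ∀ i x, Φ i x ≤ 1) (x y : X) :
    familySup Φ x ≤ familySup Φ y + familyDist Φ x y := by
  refine Real.iSup_le (fun i => ?_)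
    (add_nonneg (Real.iSup_nonneg fun i => h0 i y) (familyDist_nonneg _ _))
  have := le_abs_self (Φ i x - Φ i y)
  linarith [abs_sub_le_familyDist h0 h1 i x y, le_familySup h1 i y]

theorem familyQuasi_quasi (h0 : ∀ i x, 0 ≤ Φ i x) (h1 : ∀ i x, Φ i x ≤ 1)
    (hr : ∀ x, 0 < familySup Φ x) {x₁ x₂ x₃ x₄ : X} {M : ℝ} (l1 : familyQuasi Φ x₁ x₂ < 1)
    (l2 : familyQuasi Φ x₂ x₃ < 1) (l3 : familyQuasi Φ x₃ x₄ < 1) (m1 : familyQuasi Φ x₁ x₂ ≤ M)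
    (m2 : familyQuasi Φ x₂ x₃ ≤ M) (m3 : familyQuasi Φ x₃ x₄ ≤ M) :
    familyQuasi Φ x₁ x₄ ≤ 8 * M := by
  have hmin : ∀ x y, 0 < min (familySup Φ x) (familySup Φ y) := fun x y => lt_min (hr x) (hr y)
  have hM : 0 ≤ M := le_trans (div_nonneg (mul_nonneg (by norm_num) (familyDist_nonneg _ _))
    (hmin x₁ x₂).le) m1
  have hlip : ∀ x y, familyQuasi Φ x y < 1 → familySup Φ x ≤ 9 / 8 * familySup Φ y ∧
      familySup Φ y ≤ 9 / 8 * familySup Φ x := fun x y h => by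
    rw [familyQuasi, div_lt_one (hmin x y)] at h
    have e1 := familySup_le_add h0 h1 x y
    have e2 := familySup_le_add h0 h1 y x
    rw [familyDist_comm y x] at e2
    have e3 := min_le_left (familySup Φ x) (familySup Φ y)
    have e4 := min_le_right (familySup Φ x) (familySup Φ y)
    constructor <;> linarith
  have hle : ∀ x y, familyQuasi Φ x y ≤ M →
      8 * familyDist Φ x y ≤ M * familySup Φ x ∧ 8 * familyDist Φ x y ≤ M * familySup Φ y := by
    intro x y h
    rw [familyQuasi, div_le_iff₀ (hmin x y)] at h
    exact ⟨h.trans (mul_le_mul_of_nonneg_left (min_le_left _ _) hM),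
      h.trans (mul_le_mul_of_nonneg_left (min_le_right _ _) hM)⟩
  have t1 := familyDist_triangle h0 h1 x₁ x₂ x₄
  have t2 := familyDist_triangle h0 h1 x₂ x₃ x₄
  obtain ⟨a1, b1⟩ := hlip _ _ l1
  obtain ⟨a2, b2⟩ := hlip _ _ l2
  obtain ⟨a3, b3⟩ := hlip _ _ l3
  obtain ⟨c1, d1⟩ := hle _ _ m1
  obtain ⟨c2, d2⟩ := hle _ _ m2
  obtain ⟨c3, d3⟩ := hle _ _ m3
  have r1 := hr x₁
  have r4 := hr x₄
  rw [familyQuasi, div_le_iff₀ (hmin x₁ x₄)]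
  rcases min_choice (familySup Φ x₁) (familySup Φ x₄) with h | h <;> rw [h]
  · have e : M * (familySup Φ x₁ + familySup Φ x₂ + familySup Φ x₃) ≤
        M * (8 * familySup Φ x₁) := mul_le_mul_of_nonneg_left (by linarith) hM
    linarith
  · have e : M * (familySup Φ x₂ + familySup Φ x₃ + familySup Φ x₄) ≤
        M * (8 * familySup Φ x₄) := mul_le_mul_of_nonneg_left (by linarith) hM
    linarith

theorem familyDist_map {g : X → X} (hg : ∀ i, ∃ j, ∀ x, Φ i (g x) = Φ j x)
    (h0 : ∀ i x, 0 ≤ Φ i x) (h1 : ∀ i x, Φ i x ≤ 1) (x y : X) :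
    familyDist Φ (g x) (g y) ≤ familyDist Φ x y := by
  refine Real.iSup_le (fun i => ?_) (familyDist_nonneg _ _)
  obtain ⟨j, hj⟩ := hg i
  rw [hj, hj]
  exact abs_sub_le_familyDist h0 h1 j x y

theorem familySup_map {g : X → X} (hg : ∀ i, ∃ j, ∀ x, Φ i (g x) = Φ j x)
    (h0 : ∀ i x, 0 ≤ Φ i x) (h1 : ∀ i x, Φ i x ≤ 1) (x : X) :
    familySup Φ (g x) ≤ familySup Φ x := by
  refine Real.iSup_le (fun i => ?_) (Real.iSup_nonneg fun i => h0 i x)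
  obtain ⟨j, hj⟩ := hg i
  rw [hj]
  exact le_familySup h1 j x

theorem familyDist_tendsto [TopologicalSpace X]
    (heq : ∀ x, ∀ ε > 0, ∀ᶠ y in 𝓝 x, ∀ i, |Φ i x - Φ i y| ≤ ε) (x : X) :
    Tendsto (fun y => familyDist Φ x y) (𝓝 x) (𝓝 0) := by
  rw [Metric.tendsto_nhds]
  intro ε hε
  filter_upwards [heq x (ε / 2) (half_pos hε)] with y hy
  rw [Real.dist_0_eq_abs, abs_of_nonneg (familyDist_nonneg _ _)]
  exact (Real.iSup_le hy (half_pos hε).le).trans_lt (half_lt_self hε)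

theorem familySup_tendsto [TopologicalSpace X] (h0 : ∀ i x, 0 ≤ Φ i x) (h1 : ∀ i x, Φ i x ≤ 1)
    (heq : ∀ x, ∀ ε > 0, ∀ᶠ y in 𝓝 x, ∀ i, |Φ i x - Φ i y| ≤ ε) (x : X) :
    Tendsto (familySup Φ) (𝓝 x) (𝓝 (familySup Φ x)) := by
  rw [tendsto_iff_dist_tendsto_zero]
  refine squeeze_zero (fun _ => dist_nonneg) (fun y => ?_) (familyDist_tendsto heq x)
  have e1 := familySup_le_add h0 h1 x y
  have e2 := familySup_le_add h0 h1 y x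
  rw [familyDist_comm y x] at e2
  rw [Real.dist_eq, abs_le]
  constructor <;> linarith

theorem familyQuasi_compact [TopologicalSpace X] (h0 : ∀ i x, 0 ≤ Φ i x) (h1 : ∀ i x, Φ i x ≤ 1)
    (heq : ∀ x, ∀ ε > 0, ∀ᶠ y in 𝓝 x, ∀ i, |Φ i x - Φ i y| ≤ ε) (hr : ∀ x, 0 < familySup Φ x)
    (hsupp : ∀ i, ∃ S, IsCompact S ∧ ∀ x, x ∉ S → Φ i x = 0) {K : Set X} (hK : IsCompact K) :
    ∃ C, IsCompact C ∧ ∀ x ∈ K, ∀ y, familyQuasi Φ x y < 1 → y ∈ C := by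
  refine hK.induction_on
    (p := fun S => ∃ C, IsCompact C ∧ ∀ x ∈ S, ∀ y, familyQuasi Φ x y < 1 → y ∈ C)
    ⟨∅, isCompact_empty, by simp⟩ ?_ ?_ ?_
  · rintro s t hst ⟨C, hC, h⟩
    exact ⟨C, hC, fun x hx => h x (hst hx)⟩
  · rintro s t ⟨C, hC, h⟩ ⟨C', hC', h'⟩
    exact ⟨C ∪ C', hC.union hC', fun x hx g hg =>
      hx.elim (fun hx => Or.inl (h x hx g hg)) fun hx => Or.inr (h' x hx g hg)⟩
  · intro x _
    have hne : Nonempty ι := by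
      by_contra hι
      rw [not_nonempty_iff] at hι
      have := hr x
      rw [familySup, Real.iSup_of_isEmpty] at this
      exact lt_irrefl _ this
    obtain ⟨i, hi⟩ := exists_lt_of_lt_ciSup (f := fun i => Φ i x) (half_lt_self (hr x))
    have hi : familySup Φ x / 2 < Φ i x := hi
    obtain ⟨S, hS, hSi⟩ := hsupp i
    have hcont : Tendsto (fun z => Φ i z - familySup Φ z / 8) (𝓝 x)
        (𝓝 (Φ i x - familySup Φ x / 8)) := by
      refine Tendsto.sub ?_ ((familySup_tendsto h0 h1 heq x).div_const 8)
      rw [tendsto_iff_dist_tendsto_zero]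
      refine squeeze_zero (fun _ => dist_nonneg) (fun y => ?_) (familyDist_tendsto heq x)
      rw [dist_comm, Real.dist_eq]
      exact abs_sub_le_familyDist h0 h1 i x y
    have hev := hcont.eventually_const_lt (u := 0) (by linarith [hr x])
    refine ⟨_, mem_nhdsWithin_of_mem_nhds hev, S, hS, fun z hz y hy => ?_⟩
    by_contra hyS
    have hz : 0 < Φ i z - familySup Φ z / 8 := hz
    rw [familyQuasi, div_lt_one (lt_min (hr z) (hr y))] at hy
    have e1 := abs_sub_le_familyDist h0 h1 i z y
    rw [hSi y hyS, sub_zero] at e1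
    linarith [le_abs_self (Φ i z), min_le_left (familySup Φ z) (familySup Φ y)]

end Family

theorem exists_invariant_properMetric {X : Type*} [TopologicalSpace X] [PolishSpace X]
    [LocallyCompactSpace X] (G : Subgroup (X ≃ₜ X))
    (hG : ∀ K : Set X, IsCompact K → IsEvenlyContinuous (underlyingMaps (returnSet G K)) ∧
      IsPointwisePrecompact (underlyingMaps (returnSet G K))) :
    ∃ ρ : X → X → ℝ, IsProperMetric ρ ∧ ∀ g ∈ G, ∀ x y, ρ (g x) (g y) = ρ x y := by
  obtain ⟨φ, hφc, hφS, hφ0, hφ1, hφU⟩ := exists_bump_sequence X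
  let Φ : ℕ × G → X → ℝ := fun i x => φ i.1 (i.2.1 x)
  have h0 : ∀ i x, 0 ≤ Φ i x := fun i x => hφ0 _ _
  have h1 : ∀ i x, Φ i x ≤ 1 := fun i x => (hφ1 _ _).trans (by
    rw [div_le_one (by positivity)]
    linarith [(Nat.cast_nonneg i.1 : (0 : ℝ) ≤ _)])
  have hsupp : ∀ i, ∃ S, IsCompact S ∧ ∀ x, x ∉ S → Φ i x = 0 := by
    rintro ⟨n, g⟩
    obtain ⟨S, hS, h⟩ := hφS n
    refine ⟨g.1 ⁻¹' S, g.1.isCompact_preimage.2 hS, fun x hx => h _ hx⟩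
  have hr : ∀ x, 0 < familySup Φ x := fun x => by
    obtain ⟨n, hn, -⟩ := hφU x univ univ_mem
    exact hn.trans_le (le_familySup h1 (n, 1) x)
  have heq : ∀ x, ∀ ε > 0, ∀ᶠ y in 𝓝 x, ∀ i, |Φ i x - Φ i y| ≤ ε := by
    intro x ε hε
    obtain ⟨N, hN⟩ := exists_nat_one_div_lt hε
    have hfin : ∀ᶠ y in 𝓝 x, ∀ n ∈ Finset.range N, ∀ g ∈ G, |φ n (g x) - φ n (g y)| < ε := by
      rw [Filter.eventually_all_finset]
      intro n _
      obtain ⟨S, hS, h⟩ := hφS n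
      exact eventually_abs_sub_lt_of_compactSupport hG (hφc n) hS h x hε
    filter_upwards [hfin] with y hy
    rintro ⟨n, g, hg⟩
    rcases lt_or_ge n N with hn | hn
    · exact (hy n (Finset.mem_range.2 hn) g hg).le
    · have hle : 1 / ((n : ℝ) + 1) ≤ 1 / ((N : ℝ) + 1) :=
        one_div_le_one_div_of_le (by positivity) (by
          have : (N : ℝ) ≤ n := Nat.cast_le.2 hn
          linarith)
      have k1 := hφ0 n (g x)
      have k2 := hφ0 n (g y)
      have k3 := hφ1 n (g x)
      have k4 := hφ1 n (g y)
      simp only [Φ, abs_le]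
      constructor <;> linarith
  have hmap : ∀ g ∈ G, ∀ i, ∃ j, ∀ x, Φ i (g x) = Φ j x := by
    rintro g hg ⟨n, k⟩
    exact ⟨(n, k * ⟨g, hg⟩), fun x => rfl⟩
  have hdG : ∀ g ∈ G, ∀ x y, familyDist Φ (g x) (g y) = familyDist Φ x y := fun g hg x y => by
    refine le_antisymm (familyDist_map (hmap g hg) h0 h1 x y) ?_
    simpa using familyDist_map (hmap _ (G.inv_mem hg)) h0 h1 (g x) (g y)
  have hrG : ∀ g ∈ G, ∀ x, familySup Φ (g x) = familySup Φ x := fun g hg x => by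
    refine le_antisymm (familySup_map (hmap g hg) h0 h1 x) ?_
    simpa using familySup_map (hmap _ (G.inv_mem hg)) h0 h1 (g x)
  let κ : CompactExhaustion X := default
  have hmin : ∀ x y, 0 < min (familySup Φ x) (familySup Φ y) := fun x y => lt_min (hr x) (hr y)
  refine exists_properMetric_of_coarse (q := familyQuasi Φ)
    (E := fun k x y => ∃ g ∈ G, g x ∈ κ k ∧ g y ∈ κ k) G (fun x y => ?_) (fun x y => ?_)
    (fun x => ?_) (fun x y => ?_) (fun x y h => ?_) (fun x => ?_)
    (fun _ _ _ _ _ => familyQuasi_quasi h0 h1 hr)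
    (fun K hK => familyQuasi_compact h0 h1 heq hr hsupp hK) (fun g hg x y => ?_)
    (fun k x y => ?_) (fun k K hK => ?_) (fun g hg k x y => ?_)
  · obtain ⟨k, hk⟩ := κ.exists_mem x
    obtain ⟨l, hl⟩ := κ.exists_mem y
    exact ⟨max k l, 1, G.one_mem, κ.subset (le_max_left k l) hk, κ.subset (le_max_right k l) hl⟩
  · exact div_nonneg (mul_nonneg (by norm_num) (familyDist_nonneg _ _)) (hmin x y).le
  · simp [familyQuasi, familyDist_self]
  · simp only [familyQuasi, familyDist_comm x y, min_comm]
  · by_contra hxy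
    obtain ⟨n, hn, hn'⟩ := hφU x {y}ᶜ (isOpen_compl_singleton.mem_nhds hxy)
    have e0 : Φ (n, 1) y = 0 := hn' y (by simp)
    have e1 := abs_sub_le_familyDist h0 h1 (n, 1) x y
    have e2 : 0 < Φ (n, 1) x := hn
    rw [e0, sub_zero, abs_of_pos e2] at e1
    rw [familyQuasi, div_eq_zero_iff] at h
    rcases h with h | h
    · linarith
    · exact (hmin x y).ne' h
  · have := ((familyDist_tendsto heq x).const_mul 8).div
      (tendsto_const_nhds.min (familySup_tendsto h0 h1 heq x)) (hmin x x).ne'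
    rw [mul_zero, zero_div] at this
    exact this
  · simp only [familyQuasi, hdG g hg, hrG g hg]
  · rintro ⟨g, hg, hx, hy⟩
    exact ⟨g, hg, hy, hx⟩
  · obtain ⟨C, hC, h⟩ := exists_compact_of_returnSet hG (hK.union (κ.isCompact k))
    refine ⟨C, hC, fun x hx y => ?_⟩
    rintro ⟨g, hg, hgx, hgy⟩
    have := h (g y) (Or.inr hgy) g⁻¹ ⟨G.inv_mem hg, x, ⟨g x, Or.inr hgx, by simp⟩, Or.inl hx⟩
    simpa using this
  · rintro ⟨h, hh, hx, hy⟩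
    exact ⟨h * g⁻¹, G.mul_mem hh (G.inv_mem hg), by simpa using hx, by simpa using hy⟩

section Necessity

variable {X : Type*} [TopologicalSpace X] {d : X → X → ℝ}

theorem IsProperMetric.surjective_of_isometry (hd : IsProperMetric d) {h : X → X}
    (hh : ∀ x y, d (h x) (h y) = d x y) {x₀ : X} (hx₀ : h x₀ = x₀) : Function.Surjective h := by
  have := hd.t2Space
  intro y
  set B := {z | d x₀ z ≤ d x₀ y}
  have hB : IsCompact B := hd.isCompact_ball _ _
  have hmaps : ∀ z ∈ B, h z ∈ B := fun z hz => by
    have h1 := hh x₀ z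
    rw [hx₀] at h1
    exact h1.trans_le hz
  have hiter : ∀ n, h^[n] y ∈ B := fun n => by
    induction n with
    | zero => exact le_refl (d x₀ y)
    | succ n ih =>
      rw [Function.iterate_succ_apply']
      exact hmaps _ ih
  have hiso : ∀ n x z, d (h^[n] x) (h^[n] z) = d x z := fun n x z => by
    induction n with
    | zero => rfl
    | succ n ih => rw [Function.iterate_succ_apply', Function.iterate_succ_apply', hh, ih]
  have himg : IsCompact (h '' B) := hB.image (hd.continuous_of_isometry hh)
  by_contra hy
  have hy' : y ∈ (h '' B)ᶜ := fun ⟨z, _, hz⟩ => hy ⟨z, hz⟩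
  obtain ⟨ε, hε, hball⟩ := hd.exists_ball_subset (himg.isClosed.isOpen_compl.mem_nhds hy')
  obtain ⟨F, hF⟩ := hd.exists_ultrafilter_limit (hyperfilter ℕ) (f := fun n => h^[n]) (x₀ := x₀)
    (R := 0) (C := 1) (fun n => by rw [Function.iterate_fixed hx₀, hd.self])
    (fun n x z => by rw [hiso, one_mul])
  have hev := ((hd.tendsto_zero (F y)).comp (hF y)).eventually_lt_const (half_pos hε)
  obtain ⟨m, hm⟩ := hev.exists
  have hgt : ∀ᶠ n in (hyperfilter ℕ : Filter ℕ), m < n :=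
    Nat.hyperfilter_le_atTop (eventually_gt_atTop m)
  obtain ⟨n, hn, hmn⟩ := (hev.and hgt).exists
  obtain ⟨k, rfl⟩ := Nat.exists_eq_add_of_lt hmn
  have h1 : d y (h^[k + 1] y) < ε := by
    rw [← hiso m, ← Function.iterate_add_apply]
    have h2 := hd.triangle (h^[m] y) (F y) (h^[m + k + 1] y)
    rw [hd.comm _ (F y)] at h2
    simp only [Function.comp_apply] at hm hn
    rw [← add_assoc]
    linarith
  refine hball _ h1 ⟨h^[k] y, hiter k, ?_⟩
  rw [Function.iterate_succ_apply']

variable {G : Subgroup (X ≃ₜ X)}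

theorem isClosed_of_isometries_eq (hd : IsProperMetric d)
    (hG : ∀ f, IsBijIsometry d f ↔ f ∈ underlyingMaps (G : Set (X ≃ₜ X))) :
    IsClosed (underlyingContinuousMaps (G : Set (X ≃ₜ X))) := by
  have := hd.t2Space
  rw [isClosed_iff_ultrafilter]
  intro F 𝒰 h𝒰 hmem
  rcases isEmpty_or_nonempty X with hX | ⟨⟨x₀⟩⟩
  · exact ⟨1, G.one_mem, ContinuousMap.ext fun x => hX.elim x⟩
  have hpt : ∀ x, Tendsto (fun f : C(X, X) => f x) 𝒰 (𝓝 (F x)) := fun x =>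
    ((continuous_eval_const x).tendsto F).mono_left h𝒰
  have hbd : ∀ᶠ f in (𝒰 : Filter C(X, X)), d x₀ (f x₀) < d x₀ (F x₀) + 1 :=
    (((hd.continuous_right x₀).tendsto _).comp (hpt x₀)).eventually_lt_const (by simp)
  set T : Set C(X, X) :=
    underlyingContinuousMaps (G : Set (X ≃ₜ X)) ∩ {f | d x₀ (f x₀) < d x₀ (F x₀) + 1}
  have hT : range (Subtype.val : T → C(X, X)) ∈ 𝒰 := by
    rw [Subtype.range_coe]
    exact inter_mem hmem hbd
  obtain ⟨F', hF', hlim⟩ := hd.exists_limit_isometry (𝒰.comap Subtype.val_injective hT)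
    (D := fun _ => d) (e := fun _ => 0) tendsto_const_nhds (fun _ => zero_le_one)
    (fun _ _ _ => le_rfl) (fun _ _ _ => by simp) (f := fun i => i.1)
    (fun i => by
      obtain ⟨g, hg, e⟩ := i.2.1
      exact (hG _).2 ⟨g, hg, congrArg (fun c : C(X, X) => (c : X → X)) e⟩)
    (x₀ := x₀) (R := d x₀ (F x₀) + 1) (fun i => le_of_lt i.2.2)
  have hFF' : ⇑F = F' := funext fun x => by
    refine tendsto_nhds_unique ((hpt x).comp ?_) (hlim x)
    rw [Ultrafilter.coe_comap]
    exact tendsto_comap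
  obtain ⟨g, hg, e⟩ := (hG F').1 hF'
  exact ⟨g, hg, ContinuousMap.ext fun x => by
    rw [hFF', ← e]
    rfl⟩

theorem symmetrizedTwoHull_of_isometries_eq (hd : IsProperMetric d)
    (hG : ∀ f, IsBijIsometry d f ↔ f ∈ underlyingMaps (G : Set (X ≃ₜ X))) :
    symmetrizedTwoHull (underlyingMaps (G : Set (X ≃ₜ X))) =
      underlyingMaps (G : Set (X ≃ₜ X)) := by
  refine Subset.antisymm (fun g hg => ?_) fun f hf x y => ⟨f, hf, rfl⟩
  have hiso : ∀ x y, d (g x) (g y) = d x y := fun x y => by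
    obtain ⟨f, hf, e⟩ := hg x y
    rw [← ((hG f).2 hf).2 x y]
    rcases pair_eq_pair_iff.1 e with h | h
    · rw [h.1, h.2]
    · rw [h.1, h.2, hd.comm]
  rw [← hG]
  refine ⟨⟨fun x y hxy => hd.eq_of_eq_zero x y (by rw [← hiso, hxy, hd.self]), ?_⟩, hiso⟩
  intro y
  obtain ⟨_, ⟨k, hk, rfl⟩, e⟩ := hg y y
  have e : g y = k y := by simpa using e
  have hki : ∀ x z, d (k x) (k z) = d x z := ((hG k).2 ⟨k, hk, rfl⟩).2
  obtain ⟨z, hz⟩ := hd.surjective_of_isometry (h := fun x => k.symm (g x)) (x₀ := y)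
    (fun x z => by rw [← hki]; simpa using hiso x z) (by simp [e]) (k.symm y)
  exact ⟨z, k.symm.injective hz⟩

theorem isEvenlyContinuous_of_isometries (hd : IsProperMetric d) {F : Set (X → X)}
    (hF : ∀ f ∈ F, ∀ x y, d (f x) (f y) = d x y) : IsEvenlyContinuous F := by
  intro x y W hW
  obtain ⟨ε, hε, h⟩ := hd.exists_ball_subset hW
  refine ⟨{z | d x z < ε / 2}, (hd.tendsto_zero x).eventually_lt_const (half_pos hε),
    {z | d y z < ε / 2}, (hd.tendsto_zero y).eventually_lt_const (half_pos hε), ?_⟩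
  rintro f hf hfx _ ⟨z, hz, rfl⟩
  have hz : d x z < ε / 2 := hz
  have hfx : d y (f x) < ε / 2 := hfx
  have h1 := hd.triangle y (f x) (f z)
  rw [hF f hf] at h1
  exact h _ (by linarith)

theorem isPointwisePrecompact_returnSet (hd : IsProperMetric d)
    (hG : ∀ g ∈ G, ∀ x y, d (g x) (g y) = d x y) {K : Set X} (hK : IsCompact K) :
    IsPointwisePrecompact (underlyingMaps (returnSet G K)) := by
  have := hd.t2Space
  intro x
  obtain ⟨M, hM⟩ := hK.bddAbove_image (hd.continuous_right x).continuousOn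
  refine (hd.isCompact_ball x (M + M)).closure_of_subset ?_
  rintro _ ⟨_, ⟨g, ⟨hg, _, ⟨z, hz, rfl⟩, hgz⟩, rfl⟩, rfl⟩
  have h1 : d x z ≤ M := hM (mem_image_of_mem _ hz)
  have h2 : d x (g z) ≤ M := hM (mem_image_of_mem _ hgz)
  have h3 := hd.triangle x (g z) (g x)
  rw [hG g hg, hd.comm z x] at h3
  exact (by linarith : d x (g x) ≤ M + M)

end Necessity

theorem mainTheorem1 {X : Type*} [TopologicalSpace X] [PolishSpace X] [LocallyCompactSpace X]
    (G : Subgroup (X ≃ₜ X)) (hGX : ¬ (Nat.card G = 1 ∧ Nat.card X = 2)) :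
    List.TFAE
      [∃ d ∈ properMetrics X, isometryMaps d = underlyingMaps (G : Set (X ≃ₜ X)),
       (∃ d ∈ properMetrics X, IsInvariantMetric G d) ∧
         ∀ d ∈ properMetrics X, IsInvariantMetric G d → ∀ ε : ℝ, 0 < ε →
           ∃ ρ ∈ properMetrics X,
             (∀ x y : X, d.dist x y ≤ ρ.dist x y ∧ ρ.dist x y ≤ (1 + ε) * d.dist x y) ∧
             isometryMaps ρ = underlyingMaps (G : Set (X ≃ₜ X)),
       IsClosed (underlyingContinuousMaps (G : Set (X ≃ₜ X))) ∧
         (∀ K : Set X, IsCompact K →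
           IsEvenlyContinuous (underlyingMaps (returnSet G K)) ∧
           IsPointwisePrecompact (underlyingMaps (returnSet G K))) ∧
         symmetrizedTwoHull (underlyingMaps (G : Set (X ≃ₜ X))) =
           underlyingMaps (G : Set (X ≃ₜ X))] := by
  tfae_have 2 → 1 := by
    rintro ⟨⟨d, hd, hdG⟩, h⟩
    obtain ⟨ρ, hρ, -, hiso⟩ := h d hd hdG 1 one_pos
    exact ⟨ρ, hρ, hiso⟩
  tfae_have 1 → 3 := by
    rintro ⟨m, hm, h⟩
    have hd := IsProperMetric.of_mem_properMetrics hm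
    have hG : ∀ f, IsBijIsometry m.dist f ↔ f ∈ underlyingMaps (G : Set (X ≃ₜ X)) := fun f => by
      rw [← h]
      rfl
    have hinv : ∀ g ∈ G, ∀ x y, m.dist (g x) (g y) = m.dist x y := fun g hg =>
      ((hG g).2 ⟨g, hg, rfl⟩).2
    refine ⟨isClosed_of_isometries_eq hd hG, fun K hK =>
      ⟨isEvenlyContinuous_of_isometries hd ?_, isPointwisePrecompact_returnSet hd hinv hK⟩,
      symmetrizedTwoHull_of_isometries_eq hd hG⟩
    rintro _ ⟨g, hg, rfl⟩
    exact hinv g hg.1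
  tfae_have 3 → 2 := by
    rintro ⟨hcl, hD, hhull⟩
    refine ⟨?_, fun m hm hmG ε hε => ?_⟩
    · obtain ⟨ρ, hρ, hρG⟩ := exists_invariant_properMetric G hD
      obtain ⟨m, hm, rfl⟩ := hρ.exists_metricSpace
      exact ⟨m, hm, hρG⟩
    · obtain ⟨ρ, hρ, hle, hiso⟩ := exists_metric_isometries_eq
        (IsProperMetric.of_mem_properMetrics hm) G hGX hmG hcl hhull hε
      obtain ⟨m', hm', rfl⟩ := hρ.exists_metricSpace
      exact ⟨m', hm', hle, Set.ext hiso⟩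
  tfae_finish
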